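/- **Theorem (Hamilton–Poincaré reduction).** Let $G$ be a (finite-dimensional, real) Lie group with Lie algebra $\mathfrak g=T_1G$ (bracket of left-invariant vector fields), let $V$ be a finite-dimensional real vector space carrying a smooth left representation of $G$, and let $G$ act on $V^*$ by the dual left action $\langle ga,v\rangle=\langle a,g^{-1}v\rangle$; write $\eta a=\frac{d}{ds}\big|_{0}\,k(s)a$, for a curve $k$ in $G$ with $k(0)=1$, $\dot k(0)=\eta\in\mathfrak g$, for the induced action of $\mathfrak g$ on $V^*$. Define $\langle \mathrm{ad}^*_\xi\mu,\eta\rangle=\langle\mu,[\xi,\eta]\rangle$ for $\mu\in\mathfrak g^*$, and $\langle b\diamond a,\eta\rangle=-\langle b,\eta a\rangle$ for $b\in V$, $a\in V^*$. Let $H:T^*G\times V^*\to\mathbb R$ be smooth and left-invariant, $H(k\,p,ka)=H(p,a)$ for all $k\in G$, where $k\,p=T^*_{kg}L_{k^{-1}}p$ for $p\in T^*_gG$. Fix $a_0\in V^*$ and put $H_{a_0}=H(\cdot,a_0)$; let $h=H|_{\mathfrak g^*\times V^*}$ be the reduced Hamiltonian, with variational derivatives $\frac{\delta h}{\delta\mu}\in\mathfrak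 g$, $\frac{\delta h}{\delta a}\in V$. Let $t_0<t_1$, let $(g(t),p(t))$, $t\in[t_0,t_1]$, be a smooth curve in $T^*G$, and set $$\mu(t)=g(t)^{-1}p(t)\in\mathfrak g^*,\qquad \xi(t)=g(t)^{-1}\dot g(t)\in\mathfrak g,\qquad a(t)=g(t)^{-1}a_0\in V^*.$$ The following statements are equivalent: 1. With $a_0$ held fixed, the variational principle $$\delta\int_{t_0}^{t_1}\{\langle p(t),\dot g(t)\rangle-H_{a_0}(g(t),p(t))\}\,dt=0$$ holds for all smooth variations $(g_\varepsilon,p_\varepsilon)$ of $(g,p)$ with $\delta g$ vanishing at the endpoints ($\delta p$ is arbitrary). 2. $(g(t),p(t))$ satisfies Hamilton's equations for $H_{a_0}$, that is $\dot q=\partial H_{a_0}/\partial p$, $\dot p=-\partial H_{a_0}/\partial q$ in canonical coordinates of $T^*G$. 3. The constrained variational principle $$\delta\int_{t_0}^{t_1}\{\langle\mu(t),\xi(t)\rangle-h(\mu(t),a(t))\}\,dt=0$$ holds for all smooth variations of $(\mu,\xi,a)$ with $\delta\mu$ arbitrary and $$\delta\xi=\dot\eta+[\xi,\eta],\qquad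 \delta a=-\eta a,$$ where $\eta(t)\in\mathfrak g$ is a smooth curve vanishing at the endpoints. 4. $\xi=\dfrac{\delta h}{\delta\mu}$, and the Lie–Poisson equations hold: $$\dot\mu=\mathrm{ad}^*_\xi\mu-\frac{\delta h}{\delta a}\diamond a,\qquad \dot a=-\frac{\delta h}{\delta\mu}\,a.$$ -/

import Mathlib

open Set Bundle
open scoped Manifold ContDiff

noncomputable section

namespace HamiltonPoincare

/-! Throughout, `G` is a finite-dimensional real Lie group modelled on `E`.
In Mathlib the tangent space `T_g G` is a type synonym of the model space `E`, so that the Lie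
algebra `𝔤 = T_1 G = GroupLieAlgebra 𝓘(ℝ, E) G` has underlying space `E`.  Elements of `𝔤` and
`𝔤*` are written below as elements of the normed spaces `E` and `E →L[ℝ] ℝ`; the Lie bracket
is always Mathlib's bracket on `GroupLieAlgebra 𝓘(ℝ, E) G`. -/

section LieGroupPart

variable {E : Type*} [NormedAddCommGroup E] [NormedSpace ℝ E]
  {G : Type*} [TopologicalSpace G] [ChartedSpace E G] [Group G]

/-- The cotangent bundle `T*M`, as a smooth vector bundle over `M`. -/
abbrev CotangentBundle (E : Type*) [NormedAddCommGroup E] [NormedSpace ℝ E]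
    (M : Type*) [TopologicalSpace M] [ChartedSpace E M] [IsManifold 𝓘(ℝ, E) 1 M] : Type _ :=
  TotalSpace (E →L[ℝ] ℝ) (fun x : M => TangentSpace 𝓘(ℝ, E) x →L[ℝ] Bundle.Trivial M ℝ x)

/-- The model with corners of the manifold `T*M`. -/
abbrev cotangentModel (E : Type*) [NormedAddCommGroup E] [NormedSpace ℝ E] :
    ModelWithCorners ℝ (E × (E →L[ℝ] ℝ)) (ModelProd E (E →L[ℝ] ℝ)) :=
  𝓘(ℝ, E).prod 𝓘(ℝ, E →L[ℝ] ℝ)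

/-- The Lie bracket of `𝔤`, read on the underlying space `E` of `𝔤`. -/
def bracket (G : Type*) [TopologicalSpace G] [ChartedSpace E G] [Group G] (ξ η : E) : E :=
  Bracket.bracket (L := GroupLieAlgebra 𝓘(ℝ, E) G) (M := GroupLieAlgebra 𝓘(ℝ, E) G) ξ η

/-- `ad*_ξ μ ∈ 𝔤*`, defined by `⟨ad*_ξ μ, η⟩ = ⟨μ, [ξ, η]⟩`. -/
def adStar (G : Type*) [TopologicalSpace G] [ChartedSpace E G] [Group G] [FiniteDimensional ℝ E]
    [LieGroup 𝓘(ℝ, E) ∞ G] (ξ : E) (μ : E →L[ℝ] ℝ) : E →L[ℝ] ℝ :=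
  LinearMap.toContinuousLinearMap
    { toFun := fun η => μ (bracket G ξ η)
      map_add' := by
        intro x y
        have : CompleteSpace E := FiniteDimensional.complete ℝ E
        have : LieGroup 𝓘(ℝ, E) (minSmoothness ℝ 3) G := by
          rw [minSmoothness_of_isRCLikeNormedField]; infer_instance
        exact (congrArg μ (lie_add (L := GroupLieAlgebra 𝓘(ℝ, E) G)
          (M := GroupLieAlgebra 𝓘(ℝ, E) G) ξ x y)).trans (map_add μ _ _)
      map_smul' := by
        intro c x
        have : CompleteSpace E := FiniteDimensional.complete ℝ E
        have : LieGroup 𝓘(ℝ, E) (minSmoothness ℝ 3) G := by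
          rw [minSmoothness_of_isRCLikeNormedField]; infer_instance
        exact (congrArg μ (lie_smul (R := ℝ) (L := GroupLieAlgebra 𝓘(ℝ, E) G)
          (M := GroupLieAlgebra 𝓘(ℝ, E) G) c ξ x)).trans (map_smul μ c _) }

variable [LieGroup 𝓘(ℝ, E) ∞ G]

/-- The covector `p ∈ T*_g G`, where `T*_g G` has underlying space `E →L[ℝ] ℝ`, as a point
`(g, p)` of `T*G`. -/
def mkCotangent (g : G) (p : E →L[ℝ] ℝ) : CotangentBundle E G := ⟨g, p⟩

/-- The fibre component `p` of a point `(g, p)` of `T*G`. -/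
def covector (α : CotangentBundle E G) : E →L[ℝ] ℝ := α.2

/-- The tangent map `T_x L_g : T_x G → T_{gx} G` of the left translation `L_g x = g x`. -/
def tangentLeft (E : Type*) [NormedAddCommGroup E] [NormedSpace ℝ E] [ChartedSpace E G]
    (g x : G) : E →L[ℝ] E :=
  mfderiv 𝓘(ℝ, E) 𝓘(ℝ, E) (fun y : G => g * y) x

/-- The left action of `G` on `T*G` by cotangent lift: `k · p = T*_{kg} L_{k⁻¹} p ∈ T*_{kg} G`
for `p ∈ T*_g G`. -/
def cotangentAct (k : G) (α : CotangentBundle E G) : CotangentBundle E G :=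
  mkCotangent (k * α.1) ((covector α).comp (tangentLeft E k⁻¹ (k * α.1)))

/-- `g⁻¹ p ∈ 𝔤*` for `p ∈ T*_g G`, that is `p ∘ T_1 L_g`. -/
def bodyMomentum (α : CotangentBundle E G) : E →L[ℝ] ℝ :=
  (covector α).comp (tangentLeft E α.1 1)

/-- The velocity `ġ(t) ∈ T_{g(t)} G` of a curve `g` in `G`, parametrised by `[t₀, t₁]`
(one-sided at the endpoints). -/
def velocity (E : Type*) [NormedAddCommGroup E] [NormedSpace ℝ E] [ChartedSpace E G]
    (t₀ t₁ : ℝ) (g : ℝ → G) (t : ℝ) : E :=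
  mfderivWithin 𝓘(ℝ, ℝ) 𝓘(ℝ, E) g (Icc t₀ t₁) t (1 : ℝ)

/-- `ξ(t) = g(t)⁻¹ ġ(t) ∈ 𝔤`. -/
def bodyVelocity (E : Type*) [NormedAddCommGroup E] [NormedSpace ℝ E] [ChartedSpace E G]
    (t₀ t₁ : ℝ) (g : ℝ → G) (t : ℝ) : E :=
  tangentLeft E (g t)⁻¹ (g t) (velocity E t₀ t₁ g t)

/-- The phase space action `∫ (⟨p, ġ⟩ - K(g, p)) dt` of a curve `α = (g, p)` in `T*G`. -/
def phaseAction (t₀ t₁ : ℝ) (K : CotangentBundle E G → ℝ) (α : ℝ → CotangentBundle E G) : ℝ :=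
  ∫ t in t₀..t₁,
    (covector (α t) (velocity E t₀ t₁ (fun s => (α s).1) t) - K (α t))

/-- `Γ ε t = (g_ε(t), p_ε(t))`, `|ε| < r`, is a smooth variation of the curve `α = (g, p)`
such that `δg = d/dε|₀ g_ε` vanishes at the endpoints; `δp` is free. -/
structure IsPhaseVariation (t₀ t₁ r : ℝ) (α : ℝ → CotangentBundle E G)
    (Γ : ℝ → ℝ → CotangentBundle E G) : Prop where
  pos : 0 < r
  smooth : ContMDiffOn 𝓘(ℝ, ℝ × ℝ) (cotangentModel E) ∞ (fun x : ℝ × ℝ => Γ x.1 x.2)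
    (Ioo (-r) r ×ˢ Icc t₀ t₁)
  base : ∀ t ∈ Icc t₀ t₁, Γ 0 t = α t
  left : mfderiv 𝓘(ℝ, ℝ) 𝓘(ℝ, E) (fun ε => (Γ ε t₀).1) 0 = 0
  right : mfderiv 𝓘(ℝ, ℝ) 𝓘(ℝ, E) (fun ε => (Γ ε t₁).1) 0 = 0

/-- The variational principle `δ ∫ (⟨p, ġ⟩ - K(g, p)) dt = 0` on `T*G`, for variations `δg`
vanishing at the endpoints. -/
def PhaseSpacePrinciple (t₀ t₁ : ℝ) (K : CotangentBundle E G → ℝ)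
    (α : ℝ → CotangentBundle E G) : Prop :=
  ∀ (r : ℝ) (Γ : ℝ → ℝ → CotangentBundle E G), IsPhaseVariation t₀ t₁ r α Γ →
    HasDerivAt (fun ε => phaseAction t₀ t₁ K (Γ ε)) 0 0

/-- Hamilton's equations `q̇ = ∂K/∂p`, `ṗ = -∂K/∂q` on `[t₀, t₁]`, in all the canonical
coordinates `(q, p) ∈ E × E*` of `T*G` through which the curve passes.  The charts of the
vector bundle `T*G` are the cotangent lifts of the charts of `G`, that is the canonical ones.
The first equation is paired with an arbitrary `y ∈ E*`, the second with an arbitrary `v ∈ E`. -/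
def HamiltonEquations (t₀ t₁ : ℝ) (K : CotangentBundle E G → ℝ)
    (α : ℝ → CotangentBundle E G) : Prop :=
  ∀ t ∈ Icc t₀ t₁, ∀ α₀ : CotangentBundle E G,
    α t ∈ (extChartAt (cotangentModel E) α₀).source →
    ∃ (q' : E) (p' : E →L[ℝ] ℝ),
      HasDerivWithinAt (fun s => extChartAt (cotangentModel E) α₀ (α s)) (q', p')
        (Icc t₀ t₁) t ∧
      (∀ y : E →L[ℝ] ℝ, y q' =
        fderiv ℝ (fun z => K ((extChartAt (cotangentModel E) α₀).symm z))
          (extChartAt (cotangentModel E) α₀ (α t)) (0, y)) ∧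
      (∀ v : E, p' v =
        - fderiv ℝ (fun z => K ((extChartAt (cotangentModel E) α₀).symm z))
          (extChartAt (cotangentModel E) α₀ (α t)) (v, 0))

end LieGroupPart

section Advected

variable {G : Type*} [TopologicalSpace G] [Group G]
  {V : Type*} [NormedAddCommGroup V] [NormedSpace ℝ V] [FiniteDimensional ℝ V]

/-- The left action of `G` on `V*` that is dual to the left representation `ρ` on `V`:
`⟨g a, v⟩ = ⟨a, g⁻¹ v⟩`. -/
def dualAct (ρ : Representation ℝ G V) (g : G) (a : V →L[ℝ] ℝ) : V →L[ℝ] ℝ :=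
  a.comp (LinearMap.toContinuousLinearMap (ρ g⁻¹))

/-- The infinitesimal action `ξ ↦ ξ a` of `𝔤` on `V*`, the derivative of `g ↦ g a` at `1`. -/
def infAct (E : Type*) [NormedAddCommGroup E] [NormedSpace ℝ E] [ChartedSpace E G]
    (ρ : Representation ℝ G V) (a : V →L[ℝ] ℝ) : E →L[ℝ] (V →L[ℝ] ℝ) :=
  mfderiv 𝓘(ℝ, E) 𝓘(ℝ, V →L[ℝ] ℝ) (fun g : G => dualAct ρ g a) 1

/-- The diamond operation `b ⋄ a ∈ 𝔤*` of `b ∈ V` and `a ∈ V*`: `⟨b ⋄ a, η⟩ = -⟨b, η a⟩`. -/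
def diamond (E : Type*) [NormedAddCommGroup E] [NormedSpace ℝ E] [ChartedSpace E G]
    (ρ : Representation ℝ G V) (b : V) (a : V →L[ℝ] ℝ) : E →L[ℝ] ℝ :=
  -((ContinuousLinearMap.apply ℝ ℝ b).comp (infAct E ρ a))

end Advected

section VarDeriv

variable {W : Type*} [NormedAddCommGroup W] [NormedSpace ℝ W] [FiniteDimensional ℝ W]

/-- The variational derivative `δF/δx ∈ W` at `x` of a function `F` on `W*`, where the bidual of
`W` is identified with `W`: `⟨y, δF/δx⟩ = DF(x) · y` for all `y ∈ W*`. -/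
def varDeriv (F : (W →L[ℝ] ℝ) → ℝ) (x : W →L[ℝ] ℝ) : W :=
  (Module.evalEquiv ℝ W).symm
    ((fderiv ℝ F x : (W →L[ℝ] ℝ) →ₗ[ℝ] ℝ) ∘ₗ
      ((LinearMap.toContinuousLinearMap : (W →ₗ[ℝ] ℝ) ≃ₗ[ℝ] (W →L[ℝ] ℝ)) :
        (W →ₗ[ℝ] ℝ) →ₗ[ℝ] (W →L[ℝ] ℝ)))

theorem apply_varDeriv (F : (W →L[ℝ] ℝ) → ℝ) (x y : W →L[ℝ] ℝ) :
    y (varDeriv F x) = fderiv ℝ F x y := by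
  have h := Module.apply_evalEquiv_symm_apply ℝ W (y : W →ₗ[ℝ] ℝ)
    ((fderiv ℝ F x : (W →L[ℝ] ℝ) →ₗ[ℝ] ℝ) ∘ₗ
      ((LinearMap.toContinuousLinearMap : (W →ₗ[ℝ] ℝ) ≃ₗ[ℝ] (W →L[ℝ] ℝ)) :
        (W →ₗ[ℝ] ℝ) →ₗ[ℝ] (W →L[ℝ] ℝ)))
  exact h

end VarDeriv

section Reduced

variable {E : Type*} [NormedAddCommGroup E] [NormedSpace ℝ E]
  {G : Type*} [TopologicalSpace G] [ChartedSpace E G] [Group G]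
  {V : Type*} [NormedAddCommGroup V] [NormedSpace ℝ V]

/-- Left invariance of `H : T*G × V* → ℝ`: `H(k α, k a) = H(α, a)`. -/
def IsLeftInvariant [LieGroup 𝓘(ℝ, E) ∞ G] [FiniteDimensional ℝ V] (ρ : Representation ℝ G V)
    (H : CotangentBundle E G × (V →L[ℝ] ℝ) → ℝ) : Prop :=
  ∀ (k : G) (α : CotangentBundle E G) (a : V →L[ℝ] ℝ),
    H (cotangentAct k α, dualAct ρ k a) = H (α, a)

/-- The reduced Hamiltonian `h : 𝔤* × V* → ℝ`, the restriction of `H` to `T*_1 G × V*`. -/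
def reducedHamiltonian [LieGroup 𝓘(ℝ, E) ∞ G] (H : CotangentBundle E G × (V →L[ℝ] ℝ) → ℝ)
    (μ : E →L[ℝ] ℝ) (a : V →L[ℝ] ℝ) : ℝ :=
  H (mkCotangent 1 μ, a)

/-- The reduced action `∫ (⟨μ, ξ⟩ - h(μ, a)) dt`. -/
def reducedAction (t₀ t₁ : ℝ) (h : (E →L[ℝ] ℝ) → (V →L[ℝ] ℝ) → ℝ)
    (μ : ℝ → E →L[ℝ] ℝ) (ξ : ℝ → E) (a : ℝ → V →L[ℝ] ℝ) : ℝ :=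
  ∫ t in t₀..t₁, (μ t (ξ t) - h (μ t) (a t))

/-- `(M ε, X ε, A ε)`, `|ε| < r`, is a smooth variation of `(μ, ξ, a)` with
`δξ = η̇ + [ξ, η]` and `δa = -η a`, where `η` is a smooth curve in `𝔤` which vanishes
at the endpoints; `δμ` is free. -/
structure IsReducedVariation [FiniteDimensional ℝ V] (ρ : Representation ℝ G V) (t₀ t₁ r : ℝ)
    (μ : ℝ → E →L[ℝ] ℝ) (ξ : ℝ → E) (a : ℝ → V →L[ℝ] ℝ) (η : ℝ → E)
    (M : ℝ → ℝ → E →L[ℝ] ℝ) (X : ℝ → ℝ → E) (A : ℝ → ℝ → V →L[ℝ] ℝ) : Prop where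
  pos : 0 < r
  smooth_M : ContDiffOn ℝ ∞ (fun x : ℝ × ℝ => M x.1 x.2) (Ioo (-r) r ×ˢ Icc t₀ t₁)
  smooth_X : ContDiffOn ℝ ∞ (fun x : ℝ × ℝ => X x.1 x.2) (Ioo (-r) r ×ˢ Icc t₀ t₁)
  smooth_A : ContDiffOn ℝ ∞ (fun x : ℝ × ℝ => A x.1 x.2) (Ioo (-r) r ×ˢ Icc t₀ t₁)
  smooth_η : ContDiffOn ℝ ∞ η (Icc t₀ t₁)
  base_M : ∀ t ∈ Icc t₀ t₁, M 0 t = μ t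
  base_X : ∀ t ∈ Icc t₀ t₁, X 0 t = ξ t
  base_A : ∀ t ∈ Icc t₀ t₁, A 0 t = a t
  left : η t₀ = 0
  right : η t₁ = 0
  deriv_X : ∀ t ∈ Icc t₀ t₁, HasDerivAt (fun ε => X ε t)
    (derivWithin η (Icc t₀ t₁) t + bracket G (ξ t) (η t)) 0
  deriv_A : ∀ t ∈ Icc t₀ t₁, HasDerivAt (fun ε => A ε t) (-(infAct E ρ (a t) (η t))) 0

/-- The constrained variational principle `δ ∫ (⟨μ, ξ⟩ - h(μ, a)) dt = 0`. -/
def ReducedPrinciple [FiniteDimensional ℝ V] (ρ : Representation ℝ G V) (t₀ t₁ : ℝ)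
    (h : (E →L[ℝ] ℝ) → (V →L[ℝ] ℝ) → ℝ)
    (μ : ℝ → E →L[ℝ] ℝ) (ξ : ℝ → E) (a : ℝ → V →L[ℝ] ℝ) : Prop :=
  ∀ (r : ℝ) (η : ℝ → E) (M : ℝ → ℝ → E →L[ℝ] ℝ) (X : ℝ → ℝ → E) (A : ℝ → ℝ → V →L[ℝ] ℝ),
    IsReducedVariation ρ t₀ t₁ r μ ξ a η M X A →
      HasDerivAt (fun ε => reducedAction t₀ t₁ h (M ε) (X ε) (A ε)) 0 0

/-- The Lie-Poisson equations on `[t₀, t₁]`: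
`ξ = δh/δμ`, `μ̇ = ad*_ξ μ - (δh/δa) ⋄ a`, `ȧ = -(δh/δμ) a`. -/
def LiePoissonEquations [FiniteDimensional ℝ E] [LieGroup 𝓘(ℝ, E) ∞ G] [FiniteDimensional ℝ V]
    (ρ : Representation ℝ G V) (t₀ t₁ : ℝ) (h : (E →L[ℝ] ℝ) → (V →L[ℝ] ℝ) → ℝ)
    (μ : ℝ → E →L[ℝ] ℝ) (ξ : ℝ → E) (a : ℝ → V →L[ℝ] ℝ) : Prop :=
  ∀ t ∈ Icc t₀ t₁,
    ξ t = varDeriv (fun m => h m (a t)) (μ t) ∧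
    HasDerivWithinAt μ
      (adStar G (ξ t) (μ t) - diamond E ρ (varDeriv (fun b => h (μ t) b) (a t)) (a t))
      (Icc t₀ t₁) t ∧
    HasDerivWithinAt a (-(infAct E ρ (a t) (varDeriv (fun m => h m (a t)) (μ t))))
      (Icc t₀ t₁) t

end Reduced

end HamiltonPoincare

end

noncomputable section

namespace HamiltonPoincare

open Filter Topology VectorField

/-! ### The Maurer–Cartan form near the identity -/

section MaurerCartan

variable {E : Type*} [NormedAddCommGroup E] [NormedSpace ℝ E]
  {G : Type*} [TopologicalSpace G] [ChartedSpace E G] [Group G]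
  {F : Type*} [NormedAddCommGroup F] [NormedSpace ℝ F]

/-! Left translation trivializes the cotangent bundle as `G × 𝔤*`, by `(g, p) ↦ (g, μ)` with `μ =
g⁻¹ p`. There `⟨p, ġ⟩ = ⟨μ, ξ⟩`, and left invariance gives `H(p, a₀) = h(μ, g⁻¹ a₀)`. So the phase
space action of a curve is its reduced action, and what remains is to see how `ξ` and `a` vary when
`g` does.

Both answers come from the left logarithmic derivative `ω = g⁻¹ dg` of a family `g(ε, t)`. With `ξ =
ω(∂_t)` and `η = ω(∂_ε)`, the Maurer–Cartan structure equation `fderivWithin_leftLogDeriv_sub` is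
exactly `δξ = η̇ + [ξ, η]`. Differentiating `g⁻¹ a₀` gives `δa = -η a`
(`hasFDerivWithinAt_dualAct_inv`); the same formula along `t` gives `ȧ = -ξ a`, so this equation is
kinematic. Hence each phase space variation induces an admissible reduced one with the same action,
and (3) implies (1).

For every admissible variation, the derivative of the reduced action is `∫ (⟨δμ, ξ - δh/δμ⟩ + ⟨μ,
η̇⟩ + ⟨ad*_ξ μ - δh/δa ⋄ a, η⟩) dt` (`IsReducedVariation.hasDerivAt_reducedAction`). Under the
Lie–Poisson equations the integrand is the total derivative of `⟨μ, η⟩`, which integrates to zero,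
so (4) implies (3). Conversely, all pairs `(η, δμ)` with `η` zero at the endpoints arise from
variations in the cotangent bundle (`exists_isPhaseVariation`), and the fundamental lemma of the
calculus of variations yields (1) ⇒ (4).

The equivalence of (2) and (4) is pointwise. In canonical coordinates `p = μ ∘ A(q)` and `ξ = A(q)
q̇`, where `A` is the Maurer–Cartan form in the chart. Substituting in Hamilton's equations leaves
the antisymmetrized derivative of `A`, which the structure equation turns into the bracket inside
`ad*_ξ μ` (`hamilton_chart_iff`). -/

/-- The map `(q, y) ↦ q⁻¹ y` of `G`, read in the preferred chart at the identity. -/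
def leftDivChart (G : Type*) [TopologicalSpace G] [ChartedSpace E G] [Group G] (q y : E) : E :=
  extChartAt 𝓘(ℝ, E) (1 : G)
    (((extChartAt 𝓘(ℝ, E) (1 : G)).symm q)⁻¹ * (extChartAt 𝓘(ℝ, E) (1 : G)).symm y)

/-- The left Maurer-Cartan form of `G`, read in the preferred chart at the identity. -/
def maurerCartanChart (G : Type*) [TopologicalSpace G] [ChartedSpace E G] [Group G] (q : E) :
    E →L[ℝ] E :=
  fderiv ℝ (leftDivChart G q) q

/-- The left logarithmic derivative `g⁻¹ dg` of a map `g` into `G`. -/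
def leftLogDeriv (S : Set F) (g : F → G) (x : F) : F →L[ℝ] E :=
  fderivWithin ℝ (fun y => extChartAt 𝓘(ℝ, E) (1 : G) ((g x)⁻¹ * g y)) S x

variable [LieGroup 𝓘(ℝ, E) ∞ G]

omit [Group G] [LieGroup 𝓘(ℝ, E) ∞ G] in
theorem contMDiffAt_extChartAt_of_eq [IsManifold 𝓘(ℝ, E) ∞ G] {x y : G} (h : y = x) :
    ContMDiffAt 𝓘(ℝ, E) 𝓘(ℝ, E) ∞ (extChartAt 𝓘(ℝ, E) x) y := by
  subst h; exact contMDiffAt_extChartAt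

theorem contMDiffAt_extChartAt_symm {x : G} {q : E} (hq : q ∈ (extChartAt 𝓘(ℝ, E) x).target) :
    ContMDiffAt 𝓘(ℝ, E) 𝓘(ℝ, E) ∞ (extChartAt 𝓘(ℝ, E) x).symm q := by
  have h := contMDiffOn_extChartAt_symm (I := 𝓘(ℝ, E)) (n := ∞) x
  exact (h q hq).contMDiffAt ((isOpen_extChartAt_target x).mem_nhds hq)

theorem contDiffAt_leftDivChart :
    ContDiffAt ℝ ∞ (Function.uncurry (leftDivChart (E := E) G))
      (extChartAt 𝓘(ℝ, E) (1 : G) 1, extChartAt 𝓘(ℝ, E) (1 : G) 1) := by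
  rw [← contMDiffAt_iff_contDiffAt]
  have h0 : (extChartAt 𝓘(ℝ, E) (1 : G)) 1 ∈ (extChartAt 𝓘(ℝ, E) (1 : G)).target :=
    mem_extChartAt_target 1
  have h := contMDiffAt_extChartAt_symm (G := G) h0
  have h1 : ContMDiffAt 𝓘(ℝ, E × E) 𝓘(ℝ, E) ∞
      (fun z : E × E => (extChartAt 𝓘(ℝ, E) (1 : G)).symm z.1)
      (extChartAt 𝓘(ℝ, E) (1 : G) 1, extChartAt 𝓘(ℝ, E) (1 : G) 1) :=
    ContMDiffAt.comp _ h contDiff_fst.contMDiff.contMDiffAt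
  have h2 : ContMDiffAt 𝓘(ℝ, E × E) 𝓘(ℝ, E) ∞
      (fun z : E × E => (extChartAt 𝓘(ℝ, E) (1 : G)).symm z.2)
      (extChartAt 𝓘(ℝ, E) (1 : G) 1, extChartAt 𝓘(ℝ, E) (1 : G) 1) :=
    ContMDiffAt.comp (x := (extChartAt 𝓘(ℝ, E) (1 : G) 1, extChartAt 𝓘(ℝ, E) (1 : G) 1))
      h contDiff_snd.contMDiff.contMDiffAt
  have h3 := (h1.inv).mul h2
  exact ContMDiffAt.comp (x := (extChartAt 𝓘(ℝ, E) (1 : G) 1, extChartAt 𝓘(ℝ, E) (1 : G) 1))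
    (contMDiffAt_extChartAt_of_eq (by simp)) h3

theorem contDiffAt_maurerCartanChart :
    ContDiffAt ℝ ∞ (maurerCartanChart (E := E) G) (extChartAt 𝓘(ℝ, E) (1 : G) 1) :=
  ContDiffAt.fderiv (n := ∞) (g := id) contDiffAt_leftDivChart contDiffAt_id (by simp)

omit [Group G] [LieGroup 𝓘(ℝ, E) ∞ G] in
theorem eventually_extChartAt_symm_apply (x : G) :
    ∀ᶠ y in 𝓝 (extChartAt 𝓘(ℝ, E) x x),
      extChartAt 𝓘(ℝ, E) x ((extChartAt 𝓘(ℝ, E) x).symm y) = y :=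
  Filter.mem_of_superset ((isOpen_extChartAt_target x).mem_nhds (mem_extChartAt_target x))
    fun _ h => (extChartAt 𝓘(ℝ, E) x).right_inv h

omit [LieGroup 𝓘(ℝ, E) ∞ G] in
theorem maurerCartanChart_one :
    maurerCartanChart G (extChartAt 𝓘(ℝ, E) (1 : G) 1) = ContinuousLinearMap.id ℝ E := by
  have : leftDivChart G (extChartAt 𝓘(ℝ, E) (1 : G) 1)
      =ᶠ[𝓝 (extChartAt 𝓘(ℝ, E) (1 : G) 1)] id := by
    filter_upwards [eventually_extChartAt_symm_apply (E := E) (1 : G)] with y hy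
    simp [leftDivChart, extChartAt_to_inv, hy, -extChartAt]
  rw [maurerCartanChart, this.fderiv_eq, fderiv_id]

/-- The left translations of `G`, read in the preferred chart at the identity. -/
def leftMulChart (G : Type*) [TopologicalSpace G] [ChartedSpace E G] [Group G] (q y : E) : E :=
  extChartAt 𝓘(ℝ, E) (1 : G)
    ((extChartAt 𝓘(ℝ, E) (1 : G)).symm q * (extChartAt 𝓘(ℝ, E) (1 : G)).symm y)

theorem contDiffAt_leftMulChart :
    ContDiffAt ℝ ∞ (Function.uncurry (leftMulChart (E := E) G))
      (extChartAt 𝓘(ℝ, E) (1 : G) 1, extChartAt 𝓘(ℝ, E) (1 : G) 1) := by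
  rw [← contMDiffAt_iff_contDiffAt]
  have h0 : (extChartAt 𝓘(ℝ, E) (1 : G)) 1 ∈ (extChartAt 𝓘(ℝ, E) (1 : G)).target :=
    mem_extChartAt_target 1
  have h := contMDiffAt_extChartAt_symm (G := G) h0
  have h1 : ContMDiffAt 𝓘(ℝ, E × E) 𝓘(ℝ, E) ∞
      (fun z : E × E => (extChartAt 𝓘(ℝ, E) (1 : G)).symm z.1)
      (extChartAt 𝓘(ℝ, E) (1 : G) 1, extChartAt 𝓘(ℝ, E) (1 : G) 1) :=
    ContMDiffAt.comp _ h contDiff_fst.contMDiff.contMDiffAt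
  have h2 : ContMDiffAt 𝓘(ℝ, E × E) 𝓘(ℝ, E) ∞
      (fun z : E × E => (extChartAt 𝓘(ℝ, E) (1 : G)).symm z.2)
      (extChartAt 𝓘(ℝ, E) (1 : G) 1, extChartAt 𝓘(ℝ, E) (1 : G) 1) :=
    ContMDiffAt.comp (x := (extChartAt 𝓘(ℝ, E) (1 : G) 1, extChartAt 𝓘(ℝ, E) (1 : G) 1))
      h contDiff_snd.contMDiff.contMDiffAt
  exact ContMDiffAt.comp (x := (extChartAt 𝓘(ℝ, E) (1 : G) 1, extChartAt 𝓘(ℝ, E) (1 : G) 1))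
    (contMDiffAt_extChartAt_of_eq (by simp)) (h1.mul h2)

/-- The left-invariant vector fields of `G`, read in the preferred chart at the identity. -/
def leftInvariantChart (G : Type*) [TopologicalSpace G] [ChartedSpace E G] [Group G] (q : E) :
    E →L[ℝ] E :=
  fderiv ℝ (leftMulChart G q) (extChartAt 𝓘(ℝ, E) (1 : G) 1)

theorem contDiffAt_leftInvariantChart :
    ContDiffAt ℝ ∞ (leftInvariantChart (E := E) G) (extChartAt 𝓘(ℝ, E) (1 : G) 1) :=
  ContDiffAt.fderiv (n := ∞) (g := fun _ => extChartAt 𝓘(ℝ, E) (1 : G) 1)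
    contDiffAt_leftMulChart contDiffAt_const (by simp)

omit [LieGroup 𝓘(ℝ, E) ∞ G] in
theorem leftInvariantChart_one :
    leftInvariantChart G (extChartAt 𝓘(ℝ, E) (1 : G) 1) = ContinuousLinearMap.id ℝ E := by
  have : leftMulChart G (extChartAt 𝓘(ℝ, E) (1 : G) 1)
      =ᶠ[𝓝 (extChartAt 𝓘(ℝ, E) (1 : G) 1)] id := by
    filter_upwards [eventually_extChartAt_symm_apply (E := E) (1 : G)] with y hy
    simp [leftMulChart, extChartAt_to_inv, hy, -extChartAt]
  rw [leftInvariantChart, this.fderiv_eq, fderiv_id]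

/-- Dividing on the left by `q` undoes multiplying on the left by `q`, so the chain rule makes the
two derivatives inverse to each other. Differentiating this identity in `q` transfers the bracket
from vector fields to the form. -/
theorem eventually_maurerCartanChart_comp_leftInvariantChart :
    ∀ᶠ q in 𝓝 (extChartAt 𝓘(ℝ, E) (1 : G) 1),
      (maurerCartanChart G q).comp (leftInvariantChart G q) = ContinuousLinearMap.id ℝ E := by
  set φ := extChartAt 𝓘(ℝ, E) (1 : G) with hφ
  set z₀ := φ 1 with hz₀
  have hz : φ.symm z₀ = 1 := extChartAt_to_inv 1
  have hd : ∀ᶠ x in 𝓝 (z₀, z₀), DifferentiableAt ℝ (Function.uncurry (leftDivChart G)) x :=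
    ((contDiffAt_leftDivChart (E := E) (G := G)).of_le (m := 1) (by simp)).eventually (by simp)
      |>.mono fun x hx => hx.differentiableAt (by simp)
  have hm : ∀ᶠ x in 𝓝 (z₀, z₀), DifferentiableAt ℝ (Function.uncurry (leftMulChart G)) x :=
    ((contDiffAt_leftMulChart (E := E) (G := G)).of_le (m := 1) (by simp)).eventually (by simp)
      |>.mono fun x hx => hx.differentiableAt (by simp)
  have hdiag : Tendsto (fun q : E => (q, q)) (𝓝 z₀) (𝓝 (z₀, z₀)) :=
    (continuous_id.prodMk continuous_id).tendsto z₀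
  have hcst : Tendsto (fun q : E => (q, z₀)) (𝓝 z₀) (𝓝 (z₀, z₀)) :=
    (continuous_id.prodMk continuous_const).tendsto z₀
  have hmul : ∀ᶠ x in 𝓝 (z₀, z₀),
      leftDivChart G x.1 (leftMulChart G x.1 x.2) = x.2 := by
    have h1 : ∀ᶠ x : E × E in 𝓝 (z₀, z₀), x.1 ∈ φ.target ∧ x.2 ∈ φ.target :=
      (((isOpen_extChartAt_target (I := 𝓘(ℝ, E)) (1 : G)).prod
        (isOpen_extChartAt_target (I := 𝓘(ℝ, E)) (1 : G))).mem_nhds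
        ⟨mem_extChartAt_target 1, mem_extChartAt_target 1⟩)
    have h2 : ∀ᶠ x : E × E in 𝓝 (z₀, z₀), φ.symm x.1 * φ.symm x.2 ∈ φ.source := by
      have hc : ContinuousAt φ.symm z₀ := continuousAt_extChartAt_symm 1
      have hc1 : ContinuousAt (fun x : E × E => φ.symm x.1 * φ.symm x.2) (z₀, z₀) := by
        have := (LieGroup.of_le (m := 0) (n := ∞) (I := 𝓘(ℝ, E)) (G := G) (by simp))
        have := topologicalGroup_of_lieGroup 𝓘(ℝ, E) ∞ (G := G)
        exact (ContinuousAt.comp (f := Prod.fst) (x := (z₀, z₀)) hc continuousAt_fst).mul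
          (ContinuousAt.comp (f := Prod.snd) (x := (z₀, z₀)) hc continuousAt_snd)
      refine hc1.preimage_mem_nhds ((isOpen_extChartAt_source (1 : G)).mem_nhds ?_)
      simp only [hz, mul_one]
      exact mem_extChartAt_source 1
    filter_upwards [h1, h2] with x hx hx'
    simp only [leftDivChart, leftMulChart, ← hφ]
    rw [φ.left_inv hx', inv_mul_cancel_left, φ.right_inv hx.2]
  have hval : ∀ᶠ q in 𝓝 z₀, leftMulChart G q z₀ = q := by
    filter_upwards [eventually_extChartAt_symm_apply (E := E) (1 : G)] with y hy
    simp only [leftMulChart, ← hφ, hz, mul_one]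
    exact hy
  filter_upwards [hdiag.eventually hd, hcst.eventually hm, hcst.eventually hmul.eventually_nhds,
    hval] with q h1 h2 h3 h4
  have e : (fun y => leftDivChart G q (leftMulChart G q y)) =ᶠ[𝓝 z₀] id := by
    have : Tendsto (fun y : E => (q, y)) (𝓝 z₀) (𝓝 (q, z₀)) :=
      (continuous_const.prodMk continuous_id).tendsto z₀
    exact this.eventually h3
  have d1 : DifferentiableAt ℝ (leftDivChart G q) (leftMulChart G q z₀) := by
    rw [h4]
    exact DifferentiableAt.comp (f := fun y : E => (q, y)) q h1
      ((differentiableAt_const q).prodMk differentiableAt_id)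
  have d2 : DifferentiableAt ℝ (leftMulChart G q) z₀ :=
    DifferentiableAt.comp (f := fun y : E => (q, y)) z₀ h2
      ((differentiableAt_const q).prodMk differentiableAt_id)
  have := fderiv_comp z₀ d1 d2
  rw [h4] at this
  rw [maurerCartanChart, leftInvariantChart, ← hφ, ← hz₀, ← this]
  exact e.fderiv_eq.trans fderiv_id

omit [Group G] [LieGroup 𝓘(ℝ, E) ∞ G] in
theorem hasFDerivAt_of_hasMFDerivAt {f : G → F} {x : G} {A : E →L[ℝ] F}
    (h : HasMFDerivAt 𝓘(ℝ, E) 𝓘(ℝ, F) f x A) :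
    HasFDerivAt (fun y => f ((extChartAt 𝓘(ℝ, E) x).symm y)) A (extChartAt 𝓘(ℝ, E) x x) := by
  have h2 := h.2
  simp only [modelWithCornersSelf_coe, range_id] at h2
  exact hasFDerivWithinAt_univ.1 h2

theorem mulInvariantVectorField_chart (v : E) {q : E}
    (hq : q ∈ (extChartAt 𝓘(ℝ, E) (1 : G)).target) :
    mfderiv 𝓘(ℝ, E) 𝓘(ℝ, E) (extChartAt 𝓘(ℝ, E) (1 : G)) ((extChartAt 𝓘(ℝ, E) (1 : G)).symm q)
      (mulInvariantVectorField (G := G) (I := 𝓘(ℝ, E)) v ((extChartAt 𝓘(ℝ, E) (1 : G)).symm q)) =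
    leftInvariantChart G q v := by
  set φ := extChartAt 𝓘(ℝ, E) (1 : G) with hφ
  have hg : φ.symm q ∈ φ.source := φ.map_target hq
  have hd1 : HasMFDerivAt 𝓘(ℝ, E) 𝓘(ℝ, E) (fun y => φ.symm q * y) 1
      (mfderiv 𝓘(ℝ, E) 𝓘(ℝ, E) (fun y => φ.symm q * y) 1) :=
    ((contMDiff_mul_left (I := 𝓘(ℝ, E)) (n := ∞)).contMDiffAt.mdifferentiableAt
      (by simp)).hasMFDerivAt
  have hd2 : HasMFDerivAt 𝓘(ℝ, E) 𝓘(ℝ, E) φ (φ.symm q * 1)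
      (mfderiv 𝓘(ℝ, E) 𝓘(ℝ, E) φ (φ.symm q * 1)) := by
    refine (mdifferentiableAt_extChartAt ?_).hasMFDerivAt
    rw [mul_one, ← extChartAt_source 𝓘(ℝ, E)]
    exact hg
  have hc := hasFDerivAt_of_hasMFDerivAt (hd2.comp (1 : G) hd1)
  rw [mul_one] at hc
  exact (congrArg (fun A : E →L[ℝ] E => A v) hc.fderiv).symm

/-- The bracket of `𝔤` is that of left-invariant fields at `1`. In the chart these fields are `q ↦
B(q) ξ` and `q ↦ B(q) η` with `B = leftInvariantChart G`, which is the identity at the base point,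
so the coordinate formula for the Lie bracket leaves only derivatives of `B`. -/
theorem bracket_eq_leftInvariantChart (ξ η : E) :
    bracket G ξ η =
      fderiv ℝ (leftInvariantChart G) (extChartAt 𝓘(ℝ, E) (1 : G) 1) ξ η -
        fderiv ℝ (leftInvariantChart G) (extChartAt 𝓘(ℝ, E) (1 : G) 1) η ξ := by
  set φ := extChartAt 𝓘(ℝ, E) (1 : G) with hφ
  set z₀ := φ 1 with hz₀
  have key : ∀ v : E, mpullbackWithin 𝓘(ℝ, E) 𝓘(ℝ, E) φ.symm
      (mulInvariantVectorField (G := G) (I := 𝓘(ℝ, E)) v) (range 𝓘(ℝ, E))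
      =ᶠ[𝓝 z₀] fun q => leftInvariantChart G q v := by
    intro v
    filter_upwards [(isOpen_extChartAt_target (1 : G)).mem_nhds (mem_extChartAt_target 1)]
      with q hq
    have h1 := mfderiv_extChartAt_comp_mfderivWithin_extChartAt_symm (I := 𝓘(ℝ, E)) hq
    have h2 := mfderivWithin_extChartAt_symm_comp_mfderiv_extChartAt (I := 𝓘(ℝ, E)) hq
    rw [mpullbackWithin_apply, ContinuousLinearMap.inverse_eq h2 h1]
    exact mulInvariantVectorField_chart v hq
  -- The manifold bracket is the coordinate bracket pulled back by the derivative of the chart; at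
  -- the chart's own base point that derivative is the identity.
  have h1 : ∀ w : E, ContinuousLinearMap.inverse
      (mfderiv 𝓘(ℝ, E) 𝓘(ℝ, E) φ 1 : E →L[ℝ] E) w = w := fun w => by
    have : (mfderiv 𝓘(ℝ, E) 𝓘(ℝ, E) φ 1 : E →L[ℝ] E) = ContinuousLinearMap.id ℝ E :=
      mfderiv_extChartAt_self
    refine (congrArg (fun A : E →L[ℝ] E => A.inverse w) this).trans ?_
    simp only [ContinuousLinearMap.inverse_id, ContinuousLinearMap.id_apply]
  have hd : DifferentiableAt ℝ (leftInvariantChart (E := E) G) z₀ :=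
    contDiffAt_leftInvariantChart.differentiableAt (by simp)
  change mlieBracket 𝓘(ℝ, E) (mulInvariantVectorField (G := G) (I := 𝓘(ℝ, E)) ξ)
    (mulInvariantVectorField (G := G) (I := 𝓘(ℝ, E)) η) 1 = _
  rw [← mlieBracketWithin_univ, mlieBracketWithin_apply]
  refine (h1 _).trans ?_
  have h2 : lieBracket ℝ (fun q => leftInvariantChart G q ξ) (fun q => leftInvariantChart G q η) z₀
      = fderiv ℝ (leftInvariantChart G) z₀ ξ η - fderiv ℝ (leftInvariantChart G) z₀ η ξ := by
    rw [lieBracket, fderiv_clm_apply hd (differentiableAt_const _),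
      fderiv_clm_apply hd (differentiableAt_const _)]
    simp [leftInvariantChart_one, hz₀, hφ, -extChartAt]
  have h3 : ∀ V W : E → E, lieBracketWithin ℝ V W (φ.symm ⁻¹' univ ∩ range 𝓘(ℝ, E)) z₀ =
      lieBracket ℝ V W z₀ := by
    intro V W
    rw [← lieBracketWithin_univ]
    simp
  exact ((h3 _ _).trans (Filter.EventuallyEq.lieBracket_vectorField_eq (key ξ) (key η))).trans h2

/-- Differentiate `ω ∘ B = id` at the identity, where `ω` and `B` are both the identity: the
derivative of `ω` is minus that of `B`. This is the structure equation at one point; left invariance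
later spreads it over `G`. -/
theorem fderiv_maurerCartanChart_sub (ξ η : E) :
    fderiv ℝ (maurerCartanChart G) (extChartAt 𝓘(ℝ, E) (1 : G) 1) η ξ -
      fderiv ℝ (maurerCartanChart G) (extChartAt 𝓘(ℝ, E) (1 : G) 1) ξ η = bracket G ξ η := by
  set z₀ := extChartAt 𝓘(ℝ, E) (1 : G) 1 with hz₀
  have hA : DifferentiableAt ℝ (maurerCartanChart (E := E) G) z₀ :=
    contDiffAt_maurerCartanChart.differentiableAt (by simp)
  have hB : DifferentiableAt ℝ (leftInvariantChart (E := E) G) z₀ :=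
    contDiffAt_leftInvariantChart.differentiableAt (by simp)
  have h := (hA.hasFDerivAt.clm_comp hB.hasFDerivAt).congr_of_eventuallyEq
    (f₁ := fun _ => ContinuousLinearMap.id ℝ E)
    (eventually_maurerCartanChart_comp_leftInvariantChart.mono fun _ h => h.symm)
  have h' := h.unique (hasFDerivAt_const _ _)
  have key : ∀ u v : E, fderiv ℝ (maurerCartanChart G) z₀ u v =
      - fderiv ℝ (leftInvariantChart G) z₀ u v := by
    intro u v
    have := congrArg (fun A : E →L[ℝ] E →L[ℝ] E => A u v) h'
    simp [maurerCartanChart_one, leftInvariantChart_one, hz₀, -extChartAt] at this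
    rw [hz₀, eq_neg_iff_add_eq_zero, add_comm]
    exact this
  rw [bracket_eq_leftInvariantChart, key, key]
  abel

end MaurerCartan

/-! ### The left logarithmic derivative and its structure equation -/

section LogDeriv

variable {E : Type*} [NormedAddCommGroup E] [NormedSpace ℝ E]
  {G : Type*} [TopologicalSpace G] [ChartedSpace E G] [Group G]
  {F : Type*} [NormedAddCommGroup F] [NormedSpace ℝ F]
  [LieGroup 𝓘(ℝ, E) ∞ G] {S : Set F} {g : F → G} {x : F}

theorem contMDiffWithinAt_inv_mul (hg : ContMDiffWithinAt 𝓘(ℝ, F) 𝓘(ℝ, E) ∞ g S x) (k : G) :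
    ContMDiffWithinAt 𝓘(ℝ, F) 𝓘(ℝ, E) ∞ (fun y => k * g y) S x :=
  (contMDiff_mul_left (I := 𝓘(ℝ, E)) (n := ∞) (a := k)).contMDiffAt.comp_contMDiffWithinAt _ hg

theorem contDiffWithinAt_extChartAt_comp {p : G}
    (hg : ContMDiffWithinAt 𝓘(ℝ, F) 𝓘(ℝ, E) ∞ g S x)
    (hp : g x ∈ (extChartAt 𝓘(ℝ, E) p).source) :
    ContDiffWithinAt ℝ ∞ (fun y => extChartAt 𝓘(ℝ, E) p (g y)) S x := by
  rw [extChartAt_source] at hp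
  exact ((contMDiffAt_extChartAt' (I := 𝓘(ℝ, E)) (n := ∞) hp).comp_contMDiffWithinAt _
    hg).contDiffWithinAt

theorem contDiffWithinAt_extChartAt_inv_mul
    (hg : ContMDiffWithinAt 𝓘(ℝ, F) 𝓘(ℝ, E) ∞ g S x) :
    ContDiffWithinAt ℝ ∞ (fun y => extChartAt 𝓘(ℝ, E) (1 : G) ((g x)⁻¹ * g y)) S x :=
  contDiffWithinAt_extChartAt_comp (contMDiffWithinAt_inv_mul hg _)
    (by rw [inv_mul_cancel]; exact mem_extChartAt_source 1)

/-- From `g(y)⁻¹ g(w) = (g(x)⁻¹ g(y))⁻¹ (g(x)⁻¹ g(w))`, the map `g` may be replaced by `g(x)⁻¹ g`,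
which stays near the identity. So `g⁻¹ dg` is locally the pullback of one smooth form in the single
chart at `1`. -/
theorem eventually_leftLogDeriv_eq (hg : ContMDiffWithinAt 𝓘(ℝ, F) 𝓘(ℝ, E) ∞ g S x)
    (hS : UniqueDiffOn ℝ S) (hx : x ∈ S) :
    ∀ᶠ y in 𝓝[S] x, leftLogDeriv S g y =
      (maurerCartanChart G (extChartAt 𝓘(ℝ, E) (1 : G) ((g x)⁻¹ * g y))).comp
        (fderivWithin ℝ (fun y => extChartAt 𝓘(ℝ, E) (1 : G) ((g x)⁻¹ * g y)) S y) := by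
  set φ := extChartAt 𝓘(ℝ, E) (1 : G) with hφ
  set χ : F → E := fun y => φ ((g x)⁻¹ * g y) with hχ
  have hχx : χ x = φ 1 := by simp [hχ, -extChartAt]
  have hχs : ContDiffWithinAt ℝ ∞ χ S x := contDiffWithinAt_extChartAt_inv_mul hg
  have h1 : ∀ᶠ y in 𝓝[S] x, (g x)⁻¹ * g y ∈ φ.source := by
    refine (contMDiffWithinAt_inv_mul hg _).continuousWithinAt.preimage_mem_nhdsWithin ?_
    rw [inv_mul_cancel]
    exact extChartAt_source_mem_nhds 1
  have h2 : ∀ᶠ y in 𝓝[S] x, DifferentiableWithinAt ℝ χ S y := by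
    have := (hχs.of_le (m := 1) (by simp)).eventually (by simp)
    rw [insert_eq_of_mem hx] at this
    exact this.mono fun y hy => hy.differentiableWithinAt (by simp)
  have h3 : ∀ᶠ y in 𝓝[S] x, DifferentiableAt ℝ (leftDivChart G (χ y)) (χ y) := by
    have hd : ∀ᶠ z in 𝓝 (φ 1, φ 1), DifferentiableAt ℝ (Function.uncurry (leftDivChart G)) z :=
      ((contDiffAt_leftDivChart (E := E) (G := G)).of_le (m := 1) (by simp)).eventually (by simp)
        |>.mono fun x hx => hx.differentiableAt (by simp)
    have hc : Tendsto (fun y => (χ y, χ y)) (𝓝[S] x) (𝓝 (φ 1, φ 1)) := by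
      rw [← hχx]
      exact hχs.continuousWithinAt.prodMk hχs.continuousWithinAt
    filter_upwards [hc.eventually hd] with y hy
    exact DifferentiableAt.comp (f := fun z : E => (χ y, z)) (χ y) hy
      ((differentiableAt_const _).prodMk differentiableAt_id)
  filter_upwards [eventually_eventually_nhdsWithin.2 h1, h1, h2, h3, self_mem_nhdsWithin]
    with y h4 h1 h2 h3 hy
  have e : ∀ w, (g x)⁻¹ * g w ∈ φ.source →
      φ ((g y)⁻¹ * g w) = leftDivChart G (χ y) (χ w) := by
    intro w hw
    simp only [leftDivChart, ← hφ, hχ]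
    rw [φ.left_inv hw, φ.left_inv h1]
    congr 1
    group
  rw [maurerCartanChart, ← fderiv_comp_fderivWithin y h3 h2 (hS y hy)]
  exact Filter.EventuallyEq.fderivWithin_eq (h4.mono e) (e y h1)

theorem contDiffWithinAt_leftLogDeriv (hg : ContMDiffWithinAt 𝓘(ℝ, F) 𝓘(ℝ, E) ∞ g S x)
    (hS : UniqueDiffOn ℝ S) (hx : x ∈ S) : ContDiffWithinAt ℝ ∞ (leftLogDeriv (E := E) S g) S x := by
  have hχ := contDiffWithinAt_extChartAt_inv_mul hg
  have hev := eventually_leftLogDeriv_eq hg hS hx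
  refine ContDiffWithinAt.congr_of_eventuallyEq ?_ hev (hev.self_of_nhdsWithin hx)
  refine ContDiffWithinAt.clm_comp ?_ (hχ.fderivWithin_right hS (by simp) hx)
  have hm : ContDiffAt ℝ ∞ (maurerCartanChart (E := E) G)
      (extChartAt 𝓘(ℝ, E) (1 : G) ((g x)⁻¹ * g x)) := by
    rw [inv_mul_cancel]
    exact contDiffAt_maurerCartanChart
  exact hm.comp_contDiffWithinAt x hχ

/-- The Maurer-Cartan structure equation. -/
theorem fderivWithin_leftLogDeriv_sub (hg : ContMDiffWithinAt 𝓘(ℝ, F) 𝓘(ℝ, E) ∞ g S x)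
    (hS : UniqueDiffOn ℝ S) (hx : x ∈ S) (hx' : x ∈ closure (interior S)) (v w : F) :
    fderivWithin ℝ (leftLogDeriv (E := E) S g) S x v w - fderivWithin ℝ (leftLogDeriv (E := E) S g) S x w v =
      bracket G (leftLogDeriv S g x w) (leftLogDeriv S g x v) := by
  set χ : F → E := fun y => extChartAt 𝓘(ℝ, E) (1 : G) ((g x)⁻¹ * g y) with hχ
  have hχx : χ x = extChartAt 𝓘(ℝ, E) (1 : G) 1 := by simp [hχ, -extChartAt]
  have hχs : ContDiffWithinAt ℝ ∞ χ S x := contDiffWithinAt_extChartAt_inv_mul hg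
  have hev := eventually_leftLogDeriv_eq hg hS hx
  have hd1 : HasFDerivWithinAt χ (fderivWithin ℝ χ S x) S x :=
    (hχs.differentiableWithinAt (by simp)).hasFDerivWithinAt
  have hd2 : HasFDerivWithinAt (fderivWithin ℝ χ S) (fderivWithin ℝ (fderivWithin ℝ χ S) S x) S x :=
    ((hχs.fderivWithin_right (m := ∞) hS (by simp) hx).differentiableWithinAt
      (by simp)).hasFDerivWithinAt
  have hm : HasFDerivAt (maurerCartanChart (E := E) G)
      (fderiv ℝ (maurerCartanChart G) (extChartAt 𝓘(ℝ, E) (1 : G) 1)) (χ x) := by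
    rw [hχx]
    exact (contDiffAt_maurerCartanChart.differentiableAt (by simp)).hasFDerivAt
  have hl := ((hm.comp_hasFDerivWithinAt x hd1).clm_comp hd2).congr_of_eventuallyEq hev
    (hev.self_of_nhdsWithin hx)
  -- Second derivatives within `S` stay symmetric at boundary points lying in the closure of the
  -- interior; this covers the endpoint times. The symmetric part then cancels from the structure
  -- equation.
  have hsymm : IsSymmSndFDerivWithinAt ℝ χ S x :=
    hχs.isSymmSndFDerivWithinAt (by simpa using ENat.LEInfty.out) hS hx' hx
  have key : ∀ u u' : F, fderivWithin ℝ (leftLogDeriv (E := E) S g) S x u u' =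
      fderivWithin ℝ (fderivWithin ℝ χ S) S x u u' +
        fderiv ℝ (maurerCartanChart G) (extChartAt 𝓘(ℝ, E) (1 : G) 1) (fderivWithin ℝ χ S x u)
          (fderivWithin ℝ χ S x u') := by
    intro u u'
    rw [hl.fderivWithin (hS x hx)]
    simp [hχx, maurerCartanChart_one, -extChartAt]
  rw [key, key, hsymm.eq v w]
  have := fderiv_maurerCartanChart_sub (G := G) (fderivWithin ℝ χ S x w) (fderivWithin ℝ χ S x v)
  change _ = bracket G (fderivWithin ℝ χ S x w) (fderivWithin ℝ χ S x v)
  rw [← this]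
  abel

omit [Group G] [LieGroup 𝓘(ℝ, E) ∞ G] in
theorem hasFDerivWithinAt_of_hasMFDerivWithinAt {A : F →L[ℝ] E}
    (h : HasMFDerivWithinAt 𝓘(ℝ, F) 𝓘(ℝ, E) g S x A) :
    HasFDerivWithinAt (fun y => extChartAt 𝓘(ℝ, E) (g x) (g y)) A S x := by
  have h2 := h.2
  simp only [modelWithCornersSelf_coe, range_id, extChartAt_model_space_eq_id,
    PartialEquiv.refl_coe, PartialEquiv.refl_symm, preimage_id, inter_univ, id_eq] at h2
  exact h2

/-- Tangent vectors at a point are read in its preferred chart. Translating by `(g x)⁻¹` lands at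
`1`, whose preferred chart is the one used in `leftLogDeriv`, so the chain rule identifies the
intrinsic `g⁻¹ dg` with it. -/
theorem tangentLeft_mfderivWithin (hg : MDifferentiableWithinAt 𝓘(ℝ, F) 𝓘(ℝ, E) g S x)
    (hS : UniqueDiffWithinAt ℝ S x) (v : F) :
    tangentLeft E (g x)⁻¹ (g x) (mfderivWithin 𝓘(ℝ, F) 𝓘(ℝ, E) g S x v) = leftLogDeriv S g x v := by
  have h1 : HasMFDerivAt 𝓘(ℝ, E) 𝓘(ℝ, E) (fun y => (g x)⁻¹ * y) (g x)
      (mfderiv 𝓘(ℝ, E) 𝓘(ℝ, E) (fun y => (g x)⁻¹ * y) (g x)) :=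
    ((contMDiff_mul_left (I := 𝓘(ℝ, E)) (n := ∞)).contMDiffAt.mdifferentiableAt
      (by simp)).hasMFDerivAt
  have hc := hasFDerivWithinAt_of_hasMFDerivWithinAt
    (h1.comp_hasMFDerivWithinAt x hg.hasMFDerivWithinAt)
  simp only [Function.comp_apply, inv_mul_cancel] at hc
  exact (congrArg (fun A : F →L[ℝ] E => A v) (hc.fderivWithin hS)).symm

end LogDeriv

/-! ### Canonical coordinates of the cotangent bundle in terms of the Maurer–Cartan form -/

section Charts

variable {E : Type*} [NormedAddCommGroup E] [NormedSpace ℝ E]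
  {G : Type*} [TopologicalSpace G] [ChartedSpace E G] [Group G]
  {F : Type*} [NormedAddCommGroup F] [NormedSpace ℝ F]
  [LieGroup 𝓘(ℝ, E) ∞ G] {S : Set F} {g : F → G} {x : F}

/-- The left Maurer-Cartan form of `G`, read in the preferred chart at `g₀`. -/
def chartForm (g₀ : G) (q : E) : E →L[ℝ] E :=
  leftLogDeriv univ (extChartAt 𝓘(ℝ, E) g₀).symm q

omit [LieGroup 𝓘(ℝ, E) ∞ G] in
theorem chartForm_eq (g₀ : G) (q : E) : chartForm g₀ q =
    fderiv ℝ (fun y => extChartAt 𝓘(ℝ, E) (1 : G) (((extChartAt 𝓘(ℝ, E) g₀).symm q)⁻¹ *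
      (extChartAt 𝓘(ℝ, E) g₀).symm y)) q := by
  rw [chartForm, leftLogDeriv, fderivWithin_univ]

theorem contMDiffWithinAt_univ_extChartAt_symm {g₀ : G} {q : E}
    (hq : q ∈ (extChartAt 𝓘(ℝ, E) g₀).target) :
    ContMDiffWithinAt 𝓘(ℝ, E) 𝓘(ℝ, E) ∞ (extChartAt 𝓘(ℝ, E) g₀).symm univ q :=
  (contMDiffAt_extChartAt_symm hq).contMDiffWithinAt

theorem contDiffAt_chartForm {g₀ : G} {q : E} (hq : q ∈ (extChartAt 𝓘(ℝ, E) g₀).target) :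
    ContDiffAt ℝ ∞ (chartForm g₀) q :=
  contDiffWithinAt_univ.1
    (contDiffWithinAt_leftLogDeriv (contMDiffWithinAt_univ_extChartAt_symm hq) uniqueDiffOn_univ
      (mem_univ _))

theorem fderiv_chartForm_sub {g₀ : G} {q : E} (hq : q ∈ (extChartAt 𝓘(ℝ, E) g₀).target)
    (v w : E) :
    fderiv ℝ (chartForm g₀) q v w - fderiv ℝ (chartForm g₀) q w v =
      bracket G (chartForm g₀ q w) (chartForm g₀ q v) := by
  have := fderivWithin_leftLogDeriv_sub (contMDiffWithinAt_univ_extChartAt_symm hq) uniqueDiffOn_univ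
    (mem_univ _) (by simp) v w
  rwa [fderivWithin_univ] at this

theorem hasFDerivAt_chartForm {g₀ : G} {q : E} (hq : q ∈ (extChartAt 𝓘(ℝ, E) g₀).target) :
    HasFDerivAt (fun y => extChartAt 𝓘(ℝ, E) (1 : G) (((extChartAt 𝓘(ℝ, E) g₀).symm q)⁻¹ *
      (extChartAt 𝓘(ℝ, E) g₀).symm y)) (chartForm g₀ q) q := by
  rw [chartForm_eq]
  refine DifferentiableAt.hasFDerivAt ?_
  exact (contDiffWithinAt_univ.1 (contDiffWithinAt_extChartAt_inv_mul
    (contMDiffWithinAt_univ_extChartAt_symm hq))).differentiableAt (by simp)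

/-- Chain rule through the chart at `g₀`: this is `ξ = A(q) q̇`, from coordinate velocity to body
velocity. -/
theorem leftLogDeriv_eq_chartForm_comp {g₀ : G}
    (hg : ContMDiffWithinAt 𝓘(ℝ, F) 𝓘(ℝ, E) ∞ g S x) (hS : UniqueDiffWithinAt ℝ S x)
    (hg₀ : g x ∈ (extChartAt 𝓘(ℝ, E) g₀).source) :
    leftLogDeriv S g x = (chartForm g₀ (extChartAt 𝓘(ℝ, E) g₀ (g x))).comp
      (fderivWithin ℝ (fun y => extChartAt 𝓘(ℝ, E) g₀ (g y)) S x) := by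
  set ψ := extChartAt 𝓘(ℝ, E) g₀ with hψ
  have h1 := hasFDerivAt_chartForm (ψ.map_source hg₀)
  have h2 : HasFDerivWithinAt (fun y => ψ (g y)) (fderivWithin ℝ (fun y => ψ (g y)) S x) S x :=
    ((contDiffWithinAt_extChartAt_comp hg hg₀).differentiableWithinAt (by simp)).hasFDerivWithinAt
  have h3 := h1.comp_hasFDerivWithinAt x h2
  have h4 : ∀ᶠ y in 𝓝[S] x, g y ∈ ψ.source :=
    hg.continuousWithinAt.preimage_mem_nhdsWithin ((isOpen_extChartAt_source g₀).mem_nhds hg₀)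
  have h5 := h3.congr_of_eventuallyEq
    (f₁ := fun y => extChartAt 𝓘(ℝ, E) (1 : G) ((g x)⁻¹ * g y)) (h4.mono fun y hy => by
      simp only [Function.comp_apply, ← hψ]
      rw [ψ.left_inv hy, ψ.left_inv hg₀])
    (by
      simp only [Function.comp_apply, ← hψ]
      rw [ψ.left_inv hg₀])
  exact h5.fderivWithin hS

theorem hasFDerivAt_tangentLeft (k y : G) :
    HasFDerivAt (fun z => extChartAt 𝓘(ℝ, E) (k * y) (k * (extChartAt 𝓘(ℝ, E) y).symm z))
      (tangentLeft E k y) (extChartAt 𝓘(ℝ, E) y y) := by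
  have h1 : HasMFDerivAt 𝓘(ℝ, E) 𝓘(ℝ, E) (fun y => k * y) y
      (mfderiv 𝓘(ℝ, E) 𝓘(ℝ, E) (fun y => k * y) y) :=
    ((contMDiff_mul_left (I := 𝓘(ℝ, E)) (n := ∞)).contMDiffAt.mdifferentiableAt
      (by simp)).hasMFDerivAt
  have h2 := h1.2
  simp only [modelWithCornersSelf_coe, range_id] at h2
  exact hasFDerivWithinAt_univ.1 h2

theorem tangentLeft_comp_tangentLeft (k l y : G) :
    (tangentLeft E k (l * y)).comp (tangentLeft E l y) = tangentLeft E (k * l) y := by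
  have h1 := hasFDerivAt_tangentLeft (E := E) l y
  have h2 := hasFDerivAt_tangentLeft (E := E) k (l * y)
  have h3 := hasFDerivAt_tangentLeft (E := E) (k * l) y
  have h4 : extChartAt 𝓘(ℝ, E) (l * y) (l * (extChartAt 𝓘(ℝ, E) y).symm (extChartAt 𝓘(ℝ, E) y y))
      = extChartAt 𝓘(ℝ, E) (l * y) (l * y) := by rw [extChartAt_to_inv]
  rw [← h4] at h2
  have h5 := HasFDerivAt.comp (f := fun z => extChartAt 𝓘(ℝ, E) (l * y)
    (l * (extChartAt 𝓘(ℝ, E) y).symm z)) (extChartAt 𝓘(ℝ, E) y y) h2 h1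
  refine h5.unique ?_
  rw [mul_assoc] at h3
  refine h3.congr_of_eventuallyEq ?_
  have hc : ContinuousAt (fun z => l * (extChartAt 𝓘(ℝ, E) y).symm z) (extChartAt 𝓘(ℝ, E) y y) := by
    have := topologicalGroup_of_lieGroup 𝓘(ℝ, E) ∞ (G := G)
    exact continuousAt_const.mul (continuousAt_extChartAt_symm y)
  have h6 : ∀ᶠ z in 𝓝 (extChartAt 𝓘(ℝ, E) y y), l * (extChartAt 𝓘(ℝ, E) y).symm z ∈
      (extChartAt 𝓘(ℝ, E) (l * y)).source := by
    refine hc.preimage_mem_nhds ((isOpen_extChartAt_source (l * y)).mem_nhds ?_)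
    rw [extChartAt_to_inv]
    exact mem_extChartAt_source _
  filter_upwards [h6] with z hz
  simp only [Function.comp_apply]
  rw [(extChartAt 𝓘(ℝ, E) (l * y)).left_inv hz, mul_assoc]

theorem tangentLeft_one (y : G) : tangentLeft E 1 y = ContinuousLinearMap.id ℝ E := by
  have h := hasFDerivAt_tangentLeft (E := E) 1 y
  rw [one_mul] at h
  refine h.unique ((hasFDerivAt_id _).congr_of_eventuallyEq ?_)
  filter_upwards [eventually_extChartAt_symm_apply (E := E) y] with z hz
  rw [one_mul, hz, id]

theorem tangentLeft_comp_inv (k : G) :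
    (tangentLeft E k 1).comp (tangentLeft E k⁻¹ k) = ContinuousLinearMap.id ℝ E := by
  have := tangentLeft_comp_tangentLeft (E := E) k k⁻¹ k
  rwa [inv_mul_cancel, mul_inv_cancel, tangentLeft_one] at this

theorem tangentLeft_inv_comp (k : G) :
    (tangentLeft E k⁻¹ k).comp (tangentLeft E k 1) = ContinuousLinearMap.id ℝ E := by
  have := tangentLeft_comp_tangentLeft (E := E) k⁻¹ k 1
  rwa [inv_mul_cancel, mul_one, tangentLeft_one] at this

theorem hasFDerivAt_tangentCoordChange {g₀ k : G} (hk : k ∈ (extChartAt 𝓘(ℝ, E) g₀).source) :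
    HasFDerivAt (fun y => extChartAt 𝓘(ℝ, E) k ((extChartAt 𝓘(ℝ, E) g₀).symm y))
      (tangentCoordChange 𝓘(ℝ, E) g₀ k k) (extChartAt 𝓘(ℝ, E) g₀ k) := by
  have := hasFDerivWithinAt_tangentCoordChange (I := 𝓘(ℝ, E)) (x := g₀) (y := k) (z := k)
    ⟨hk, mem_extChartAt_source k⟩
  simp only [modelWithCornersSelf_coe, range_id] at this
  exact hasFDerivWithinAt_univ.1 this

/-- `chartForm` reads a coordinate vector as an element of `𝔤`; translating it back to `k` returns
the same vector, now expressed in the preferred chart at `k`. This links left translation to the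
bundle's own coordinate changes. -/
theorem tangentLeft_comp_chartForm {g₀ k : G} (hk : k ∈ (extChartAt 𝓘(ℝ, E) g₀).source) :
    (tangentLeft E k 1).comp (chartForm g₀ (extChartAt 𝓘(ℝ, E) g₀ k)) =
      tangentCoordChange 𝓘(ℝ, E) g₀ k k := by
  set ψ := extChartAt 𝓘(ℝ, E) g₀ with hψ
  have h1 := hasFDerivAt_chartForm (ψ.map_source hk)
  rw [← hψ, ψ.left_inv hk] at h1
  have h2 := hasFDerivAt_tangentLeft (E := E) k 1
  rw [mul_one] at h2
  have h4 : extChartAt 𝓘(ℝ, E) (1 : G) (k⁻¹ * ψ.symm (ψ k)) = extChartAt 𝓘(ℝ, E) (1 : G) 1 := by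
    rw [ψ.left_inv hk, inv_mul_cancel]
  rw [← h4] at h2
  have h5 := HasFDerivAt.comp (f := fun z => extChartAt 𝓘(ℝ, E) (1 : G) (k⁻¹ * ψ.symm z))
    (ψ k) h2 h1
  refine h5.unique ((hasFDerivAt_tangentCoordChange hk).congr_of_eventuallyEq ?_)
  have hc : ContinuousAt (fun z => k⁻¹ * ψ.symm z) (ψ k) := by
    have := topologicalGroup_of_lieGroup 𝓘(ℝ, E) ∞ (G := G)
    exact continuousAt_const.mul (continuousAt_extChartAt_symm' hk)
  have h6 : ∀ᶠ z in 𝓝 (ψ k), k⁻¹ * ψ.symm z ∈ (extChartAt 𝓘(ℝ, E) (1 : G)).source := by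
    refine hc.preimage_mem_nhds ((isOpen_extChartAt_source 1).mem_nhds ?_)
    rw [ψ.left_inv hk, inv_mul_cancel]
    exact mem_extChartAt_source _
  filter_upwards [h6] with z hz
  simp only [Function.comp_apply]
  rw [(extChartAt 𝓘(ℝ, E) (1 : G)).left_inv hz, mul_inv_cancel_left]

theorem isInvertible_chartForm {g₀ : G} {q : E} (hq : q ∈ (extChartAt 𝓘(ℝ, E) g₀).target) :
    (chartForm g₀ q).IsInvertible := by
  set ψ := extChartAt 𝓘(ℝ, E) g₀ with hψ
  have hk := ψ.map_target hq
  set k := ψ.symm q with hkdef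
  have hqk : q = ψ k := (ψ.right_inv hq).symm
  have h1 := tangentLeft_comp_chartForm hk
  have h2 : ∀ v, tangentCoordChange 𝓘(ℝ, E) k g₀ k (tangentCoordChange 𝓘(ℝ, E) g₀ k k v) = v := by
    intro v
    rw [tangentCoordChange_comp ⟨⟨hk, mem_extChartAt_source k⟩, hk⟩, tangentCoordChange_self hk]
  have h3 : ∀ v, tangentCoordChange 𝓘(ℝ, E) g₀ k k (tangentCoordChange 𝓘(ℝ, E) k g₀ k v) = v := by
    intro v
    rw [tangentCoordChange_comp ⟨⟨mem_extChartAt_source k, hk⟩, mem_extChartAt_source k⟩,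
      tangentCoordChange_self (mem_extChartAt_source k)]
  rw [← hψ, ← hqk] at h1
  refine ContinuousLinearMap.IsInvertible.of_inverse
    (g := (tangentCoordChange 𝓘(ℝ, E) k g₀ k).comp (tangentLeft E k 1)) ?_ ?_
  · have h4 : chartForm g₀ q = (tangentLeft E k⁻¹ k).comp (tangentCoordChange 𝓘(ℝ, E) g₀ k k) := by
      rw [← h1, ← ContinuousLinearMap.comp_assoc, tangentLeft_inv_comp,
        ContinuousLinearMap.id_comp]
    ext v
    rw [h4]
    simp only [ContinuousLinearMap.comp_apply, ContinuousLinearMap.id_apply, h3]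
    exact congrArg (fun A : E →L[ℝ] E => A v) (tangentLeft_inv_comp (E := E) k)
  · rw [ContinuousLinearMap.comp_assoc, h1]
    ext v
    exact h2 v

theorem mem_extChartAt_cotangent_source {α₀ α : CotangentBundle E G} :
    α ∈ (extChartAt (cotangentModel E) α₀).source ↔ α.1 ∈ (extChartAt 𝓘(ℝ, E) α₀.1).source := by
  rw [FiberBundle.extChartAt]
  simp only [PartialEquiv.trans_source, PartialEquiv.prod_source, PartialEquiv.refl_source,
    mem_inter_iff, mem_preimage, mem_prod, mem_univ, and_true]
  constructor
  · exact fun h => h.2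
  · refine fun h => ⟨(Trivialization.mem_source _).2 ?_, h⟩
    rw [extChartAt_source] at h
    simpa using h

/-- A covector is trivialized by precomposition with the tangent coordinate change, since the target
line bundle is trivial. Factoring that change through `𝔤` gives `p = μ ∘ A(q)`. -/
theorem trivializationAt_cotangent {g₀ : G} {α : CotangentBundle E G}
    (h : α.1 ∈ (extChartAt 𝓘(ℝ, E) g₀).source) :
    (trivializationAt (E →L[ℝ] ℝ)
      (fun x : G => TangentSpace 𝓘(ℝ, E) x →L[ℝ] Bundle.Trivial G ℝ x) g₀ α).2 =
    (bodyMomentum α).comp (chartForm g₀ (extChartAt 𝓘(ℝ, E) g₀ α.1)) := by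
  rw [bodyMomentum, ContinuousLinearMap.comp_assoc, tangentLeft_comp_chartForm h]
  rw [extChartAt_source] at h
  have h1 := TangentBundle.symmL_trivializationAt_eq_core (I := 𝓘(ℝ, E)) h
  ext v
  have h2 := congrArg (fun A : E →L[ℝ] E => covector α (A v)) h1
  refine Eq.trans ?_ h2
  rw [hom_trivializationAt_apply]
  simp [ContinuousLinearMap.inCoordinates]
  rfl

theorem extChartAt_cotangent {α₀ α : CotangentBundle E G}
    (h : α.1 ∈ (extChartAt 𝓘(ℝ, E) α₀.1).source) :
    extChartAt (cotangentModel E) α₀ α = (extChartAt 𝓘(ℝ, E) α₀.1 α.1,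
      (bodyMomentum α).comp (chartForm α₀.1 (extChartAt 𝓘(ℝ, E) α₀.1 α.1))) := by
  rw [← trivializationAt_cotangent h, FiberBundle.extChartAt]
  rfl

end Charts

/-! ### Left trivialization of the cotangent bundle and the reduced Hamiltonian -/

section Cotangent

variable {E : Type*} [NormedAddCommGroup E] [NormedSpace ℝ E]
  {G : Type*} [TopologicalSpace G] [ChartedSpace E G] [Group G]
  {F : Type*} [NormedAddCommGroup F] [NormedSpace ℝ F]
  [LieGroup 𝓘(ℝ, E) ∞ G] {S : Set F} {g : F → G} {x : F}

/-- The covector at `g` whose left translate to the identity is `μ`. -/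
def ofBody (g : G) (μ : E →L[ℝ] ℝ) : CotangentBundle E G :=
  mkCotangent g (μ.comp (tangentLeft E g⁻¹ g))

theorem ofBody_fst (g : G) (μ : E →L[ℝ] ℝ) : (ofBody g μ).1 = g := rfl

theorem bodyMomentum_ofBody (g : G) (μ : E →L[ℝ] ℝ) : bodyMomentum (ofBody g μ) = μ := by
  change (μ.comp (tangentLeft E g⁻¹ g)).comp (tangentLeft E g 1) = μ
  rw [ContinuousLinearMap.comp_assoc, tangentLeft_inv_comp, ContinuousLinearMap.comp_id]

theorem ofBody_bodyMomentum (α : CotangentBundle E G) : ofBody α.1 (bodyMomentum α) = α := by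
  have : (bodyMomentum α).comp (tangentLeft E (α.1)⁻¹ α.1) = covector α := by
    rw [bodyMomentum, ContinuousLinearMap.comp_assoc, tangentLeft_comp_inv,
      ContinuousLinearMap.comp_id]
  rw [ofBody, this]
  rfl

theorem ofBody_one (μ : E →L[ℝ] ℝ) : ofBody (1 : G) μ = mkCotangent 1 μ := by
  rw [ofBody, inv_one, tangentLeft_one, ContinuousLinearMap.comp_id]

theorem cotangentAct_inv (α : CotangentBundle E G) :
    cotangentAct (α.1)⁻¹ α = mkCotangent 1 (bodyMomentum α) := by
  rw [cotangentAct, inv_inv, inv_mul_cancel, bodyMomentum]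

theorem covector_eq_bodyMomentum_comp (α : CotangentBundle E G) (v : E) :
    covector α v = bodyMomentum α (tangentLeft E (α.1)⁻¹ α.1 v) := by
  have : (bodyMomentum α).comp (tangentLeft E (α.1)⁻¹ α.1) = covector α := by
    rw [bodyMomentum, ContinuousLinearMap.comp_assoc, tangentLeft_comp_inv,
      ContinuousLinearMap.comp_id]
  rw [← this]
  rfl

theorem extChartAt_cotangent_symm (α₀ : CotangentBundle E G) {q : E}
    (hq : q ∈ (extChartAt 𝓘(ℝ, E) α₀.1).target) (p : E →L[ℝ] ℝ) :
    (extChartAt (cotangentModel E) α₀).symm (q, p) =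
      ofBody ((extChartAt 𝓘(ℝ, E) α₀.1).symm q) (p.comp (chartForm α₀.1 q).inverse) := by
  set k := (extChartAt 𝓘(ℝ, E) α₀.1).symm q with hk
  have h1 : k ∈ (extChartAt 𝓘(ℝ, E) α₀.1).source := (extChartAt 𝓘(ℝ, E) α₀.1).map_target hq
  have h2 : extChartAt 𝓘(ℝ, E) α₀.1 k = q := (extChartAt 𝓘(ℝ, E) α₀.1).right_inv hq
  have h := extChartAt_cotangent (α₀ := α₀)
    (α := ofBody k (p.comp (chartForm α₀.1 q).inverse)) h1
  rw [ofBody_fst, bodyMomentum_ofBody, h2, ContinuousLinearMap.comp_assoc,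
    (isInvertible_chartForm hq).inverse_comp_self, ContinuousLinearMap.comp_id] at h
  rw [← h]
  exact (extChartAt (cotangentModel E) α₀).left_inv (mem_extChartAt_cotangent_source.2 h1)

variable [FiniteDimensional ℝ E]

/-- The fibre coordinate is `μ ∘ A(q)` with `A` smooth and invertible, and inversion of operators is
smooth, so either of `p` and `μ` is smooth when the other is. From here on smoothness in the
cotangent bundle is handled in `G × 𝔤*`. -/
theorem contMDiffWithinAt_cotangent_iff {Γ : F → CotangentBundle E G} :
    ContMDiffWithinAt 𝓘(ℝ, F) (cotangentModel E) ∞ Γ S x ↔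
      ContMDiffWithinAt 𝓘(ℝ, F) 𝓘(ℝ, E) ∞ (fun y => (Γ y).1) S x ∧
        ContDiffWithinAt ℝ ∞ (fun y => bodyMomentum (Γ y)) S x := by
  have : CompleteSpace E := FiniteDimensional.complete ℝ E
  rw [Bundle.contMDiffWithinAt_totalSpace, contMDiffWithinAt_iff_contDiffWithinAt]
  refine and_congr_right fun h => ?_
  set ψ := extChartAt 𝓘(ℝ, E) (Γ x).1 with hψ
  have hx : (Γ x).1 ∈ ψ.source := mem_extChartAt_source _
  have h1 : ∀ᶠ y in 𝓝[insert x S] x, (Γ y).1 ∈ ψ.source := by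
    have := h.continuousWithinAt.insert
    exact this.preimage_mem_nhdsWithin (extChartAt_source_mem_nhds _)
  have hq : ContDiffWithinAt ℝ ∞ (fun y => ψ (Γ y).1) S x := contDiffWithinAt_extChartAt_comp h hx
  have hA : ContDiffAt ℝ ∞ (chartForm (E := E) (Γ x).1) (ψ (Γ x).1) :=
    contDiffAt_chartForm (ψ.map_source hx)
  have hA' : ContDiffAt ℝ ∞ (fun q => (chartForm (E := E) (Γ x).1 q).inverse) (ψ (Γ x).1) := by
    obtain ⟨e, he⟩ := isInvertible_chartForm (ψ.map_source hx)
    have hi : ContDiffAt ℝ ∞ (ContinuousLinearMap.inverse : (E →L[ℝ] E) → E →L[ℝ] E)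
        (chartForm (Γ x).1 (ψ (Γ x).1)) := by
      rw [← he]
      exact contDiffAt_map_inverse e
    exact hi.comp _ hA
  constructor
  · intro h2
    have h3 := h2.clm_comp (hA'.comp_contDiffWithinAt x hq)
    refine h3.congr_of_eventuallyEq_insert ?_
    filter_upwards [h1] with y hy
    rw [trivializationAt_cotangent hy]
    simp only [Function.comp_apply]
    rw [ContinuousLinearMap.comp_assoc,
      (isInvertible_chartForm (ψ.map_source hy)).self_comp_inverse, ContinuousLinearMap.comp_id]
  · intro h2
    have h3 := h2.clm_comp (hA.comp_contDiffWithinAt x hq)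
    refine h3.congr_of_eventuallyEq_insert ?_
    filter_upwards [h1] with y hy
    rw [trivializationAt_cotangent hy]
    rfl

variable {V : Type*} [NormedAddCommGroup V] [NormedSpace ℝ V] [FiniteDimensional ℝ V]
  {ρ : Representation ℝ G V} {H : CotangentBundle E G × (V →L[ℝ] ℝ) → ℝ}

omit [FiniteDimensional ℝ E] in
-- Act by `g⁻¹`, which carries the covector to the fibre over `1`.
theorem IsLeftInvariant.eq_reducedHamiltonian (hinv : IsLeftInvariant ρ H)
    (α : CotangentBundle E G) (a : V →L[ℝ] ℝ) :
    H (α, a) = reducedHamiltonian H (bodyMomentum α) (dualAct ρ (α.1)⁻¹ a) := by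
  rw [reducedHamiltonian, ← cotangentAct_inv, hinv]

omit [FiniteDimensional ℝ V] in
theorem contDiff_reducedHamiltonian
    (hH : ContMDiff ((cotangentModel E).prod 𝓘(ℝ, V →L[ℝ] ℝ)) 𝓘(ℝ, ℝ) ∞ H) :
    ContDiff ℝ ∞ (fun z : (E →L[ℝ] ℝ) × (V →L[ℝ] ℝ) => reducedHamiltonian H z.1 z.2) := by
  rw [← contMDiff_iff_contDiff]
  have h1 : ContMDiff 𝓘(ℝ, (E →L[ℝ] ℝ) × (V →L[ℝ] ℝ)) (cotangentModel E) ∞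
      (fun z : (E →L[ℝ] ℝ) × (V →L[ℝ] ℝ) => (mkCotangent 1 z.1 : CotangentBundle E G)) := by
    intro z
    rw [← contMDiffWithinAt_univ, contMDiffWithinAt_cotangent_iff]
    refine ⟨contMDiffWithinAt_const, ?_⟩
    have : (fun y : (E →L[ℝ] ℝ) × (V →L[ℝ] ℝ) =>
        bodyMomentum (mkCotangent 1 y.1 : CotangentBundle E G)) = Prod.fst := by
      ext1 y
      rw [← ofBody_one, bodyMomentum_ofBody]
    rw [this]
    exact contDiffWithinAt_fst
  exact hH.comp (h1.prodMk contDiff_snd.contMDiff)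

end Cotangent

/-! ### The representation and the advected parameter -/

section Rep

variable {E : Type*} [NormedAddCommGroup E] [NormedSpace ℝ E]
  {G : Type*} [TopologicalSpace G] [ChartedSpace E G] [Group G]
  {F : Type*} [NormedAddCommGroup F] [NormedSpace ℝ F]
  {S : Set F} {g : F → G} {x : F}
  {V : Type*} [NormedAddCommGroup V] [NormedSpace ℝ V] [FiniteDimensional ℝ V]
  (ρ : Representation ℝ G V)

/-- The representation operator `ρ g` as a continuous linear map. -/
def repCLM (g : G) : V →L[ℝ] V := LinearMap.toContinuousLinearMap (ρ g)

omit [TopologicalSpace G] in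
theorem repCLM_mul (g k : G) : repCLM ρ (g * k) = (repCLM ρ g).comp (repCLM ρ k) := by
  ext v
  simp [repCLM]

omit [TopologicalSpace G] in
theorem repCLM_one : repCLM ρ 1 = ContinuousLinearMap.id ℝ V := by
  ext v
  simp [repCLM]

omit [TopologicalSpace G] in
theorem dualAct_inv (g : G) (a : V →L[ℝ] ℝ) : dualAct ρ g⁻¹ a = a.comp (repCLM ρ g) := by
  rw [dualAct, inv_inv, repCLM]

/-- The infinitesimal representation of the Lie algebra on `V`. -/
def infRep (E : Type*) [NormedAddCommGroup E] [NormedSpace ℝ E] [ChartedSpace E G]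
    (ρ : Representation ℝ G V) : E →L[ℝ] V →L[ℝ] V :=
  fderiv ℝ (fun z => repCLM ρ ((extChartAt 𝓘(ℝ, E) (1 : G)).symm z)) (extChartAt 𝓘(ℝ, E) (1 : G) 1)

variable {ρ} [LieGroup 𝓘(ℝ, E) ∞ G]
  (hρ : ContMDiff (𝓘(ℝ, E).prod 𝓘(ℝ, V)) 𝓘(ℝ, V) ∞ (fun x : G × V => ρ x.1 x.2))

include hρ

omit [LieGroup 𝓘(ℝ, E) ∞ G] in
-- Joint smoothness on `G × V` gives smoothness in operator norm because, in a finite basis, the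
-- operator is a finite sum of coordinate functionals times the smooth vectors `ρ g (b i)`.
theorem contMDiff_repCLM : ContMDiff 𝓘(ℝ, E) 𝓘(ℝ, V →L[ℝ] V) ∞ (repCLM ρ) := by
  let b := Module.finBasis ℝ V
  have h : repCLM ρ = fun g => ∑ i, ContinuousLinearMap.smulRightL ℝ V V
      (LinearMap.toContinuousLinearMap (b.coord i)) (ρ g (b i)) := by
    ext g v
    have := congrArg (ρ g) (b.sum_repr v)
    simp only [map_sum, map_smul] at this
    simp [repCLM, ← this]
  have h1 : ∀ i, ContMDiff 𝓘(ℝ, E) 𝓘(ℝ, V →L[ℝ] V) ∞ (fun g : G =>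
      ContinuousLinearMap.smulRightL ℝ V V
        (LinearMap.toContinuousLinearMap (b.coord i)) (ρ g (b i))) := by
    intro i
    have h2 : ContMDiff 𝓘(ℝ, E) 𝓘(ℝ, V) ∞ (fun g : G => ρ g (b i)) :=
      hρ.comp (contMDiff_id.prodMk contMDiff_const)
    exact (ContinuousLinearMap.contDiff _).contMDiff.comp h2
  rw [h]
  exact ContMDiff.sum fun i _ => h1 i

theorem hasFDerivAt_infRep :
    HasFDerivAt (fun z => repCLM ρ ((extChartAt 𝓘(ℝ, E) (1 : G)).symm z)) (infRep E ρ)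
      (extChartAt 𝓘(ℝ, E) (1 : G) 1) := by
  have h : ContMDiffAt 𝓘(ℝ, E) 𝓘(ℝ, V →L[ℝ] V) ∞
      (fun z => repCLM ρ ((extChartAt 𝓘(ℝ, E) (1 : G)).symm z)) (extChartAt 𝓘(ℝ, E) (1 : G) 1) :=
    (contMDiff_repCLM hρ).contMDiffAt.comp _ (contMDiffAt_extChartAt_symm (mem_extChartAt_target 1))
  exact (h.contDiffAt.differentiableAt (by simp)).hasFDerivAt

/-- The dual action involves `ρ g⁻¹`; differentiating `ρ g ∘ ρ g⁻¹ = id` at `1` produces the minus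
sign. -/
theorem infAct_apply (a : V →L[ℝ] ℝ) (η : E) : infAct E ρ a η = -(a.comp (infRep E ρ η)) := by
  set φ := extChartAt 𝓘(ℝ, E) (1 : G) with hφ
  have hd := hasFDerivAt_infRep hρ
  have hinvd : ContMDiff 𝓘(ℝ, E) 𝓘(ℝ, V →L[ℝ] V) ∞ (fun g => repCLM ρ g⁻¹) :=
    (contMDiff_repCLM hρ).comp (contMDiff_inv 𝓘(ℝ, E) ∞)
  have h1 : DifferentiableAt ℝ (fun z => repCLM ρ (φ.symm z)⁻¹) (φ 1) := by
    have h : ContMDiffAt 𝓘(ℝ, E) 𝓘(ℝ, V →L[ℝ] V) ∞ (fun z => repCLM ρ (φ.symm z)⁻¹) (φ 1) :=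
      ContMDiffAt.comp (g := fun g => repCLM ρ g⁻¹) _ hinvd.contMDiffAt
        (contMDiffAt_extChartAt_symm (mem_extChartAt_target 1))
    exact h.contDiffAt.differentiableAt (by simp)
  have h2 := (hd.clm_comp h1.hasFDerivAt)
  have h3 : (fun z => (repCLM ρ (φ.symm z)).comp (repCLM ρ (φ.symm z)⁻¹)) =
      fun _ => ContinuousLinearMap.id ℝ V := by
    ext1 z
    rw [← repCLM_mul, mul_inv_cancel, repCLM_one]
  rw [← hφ, h3] at h2
  have h4 := h2.unique (hasFDerivAt_const _ _)
  have h5 : fderiv ℝ (fun z => repCLM ρ (φ.symm z)⁻¹) (φ 1) η = -infRep E ρ η := by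
    have := congrArg (fun A : E →L[ℝ] V →L[ℝ] V => A η) h4
    simp only [hφ, extChartAt_to_inv, inv_one, repCLM_one] at this
    rw [eq_neg_iff_add_eq_zero, hφ]
    simpa [-extChartAt] using this
  have hm : ContMDiff 𝓘(ℝ, E) 𝓘(ℝ, V →L[ℝ] ℝ) ∞ (fun g => dualAct ρ g a) :=
    ((ContinuousLinearMap.compL ℝ V V ℝ a).contDiff.contMDiff).comp hinvd
  have h6 := hasFDerivAt_of_hasMFDerivAt (hm.contMDiffAt.mdifferentiableAt
    (x := 1) (by simp)).hasMFDerivAt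
  have h7 : HasFDerivAt (fun z => dualAct ρ (φ.symm z) a)
      ((ContinuousLinearMap.compL ℝ V V ℝ a).comp
        (fderiv ℝ (fun z => repCLM ρ (φ.symm z)⁻¹) (φ 1))) (φ 1) :=
    (ContinuousLinearMap.compL ℝ V V ℝ a).hasFDerivAt.comp _ h1.hasFDerivAt
  have h8 := congrArg (fun A : E →L[ℝ] V →L[ℝ] ℝ => A η) (h6.unique h7)
  refine h8.trans ?_
  simp [h5]

omit [LieGroup 𝓘(ℝ, E) ∞ G] in
theorem contDiffWithinAt_dualAct_inv (hg : ContMDiffWithinAt 𝓘(ℝ, F) 𝓘(ℝ, E) ∞ g S x)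
    (a : V →L[ℝ] ℝ) : ContDiffWithinAt ℝ ∞ (fun y => dualAct ρ (g y)⁻¹ a) S x := by
  have h : ContMDiffWithinAt 𝓘(ℝ, F) 𝓘(ℝ, V →L[ℝ] V) ∞ (fun y => repCLM ρ (g y)) S x :=
    (contMDiff_repCLM hρ).contMDiffAt.comp_contMDiffWithinAt _ hg
  simp only [dualAct_inv]
  exact contDiffWithinAt_const.clm_comp h.contDiffWithinAt

/-- Write `g(y)⁻¹ a₀ = (g(x)⁻¹ a₀) ∘ ρ(g(x)⁻¹ g(y))`, so that only the derivative of `ρ` at the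
identity enters. Applied along `ε` it gives `δa = -η a`, along `t` it gives `ȧ = -ξ a`. -/
theorem hasFDerivWithinAt_dualAct_inv (hg : ContMDiffWithinAt 𝓘(ℝ, F) 𝓘(ℝ, E) ∞ g S x)
    (a : V →L[ℝ] ℝ) :
    HasFDerivWithinAt (fun y => dualAct ρ (g y)⁻¹ a)
      (-((infAct E ρ (dualAct ρ (g x)⁻¹ a)).comp (leftLogDeriv S g x))) S x := by
  set φ := extChartAt 𝓘(ℝ, E) (1 : G) with hφ
  have h1 : HasFDerivWithinAt (fun y => φ ((g x)⁻¹ * g y)) (leftLogDeriv S g x) S x :=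
    ((contDiffWithinAt_extChartAt_inv_mul hg).differentiableWithinAt (by simp)).hasFDerivWithinAt
  have hd : HasFDerivAt (fun z => repCLM ρ (φ.symm z)) (infRep E ρ) (φ ((g x)⁻¹ * g x)) := by
    rw [inv_mul_cancel]
    exact hasFDerivAt_infRep hρ
  have h2 := (ContinuousLinearMap.compL ℝ V V ℝ (dualAct ρ (g x)⁻¹ a)).hasFDerivAt.comp_hasFDerivWithinAt
    x (hd.comp_hasFDerivWithinAt x h1)
  have h3 : ∀ y, (g x)⁻¹ * g y ∈ φ.source → dualAct ρ (g y)⁻¹ a =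
      (dualAct ρ (g x)⁻¹ a).comp (repCLM ρ (φ.symm (φ ((g x)⁻¹ * g y)))) := by
    intro y hy
    rw [φ.left_inv hy, dualAct_inv, dualAct_inv, ContinuousLinearMap.comp_assoc, ← repCLM_mul,
      mul_inv_cancel_left]
  have h4 : ∀ᶠ y in 𝓝[S] x, (g x)⁻¹ * g y ∈ φ.source := by
    refine (contMDiffWithinAt_inv_mul hg _).continuousWithinAt.preimage_mem_nhdsWithin ?_
    rw [inv_mul_cancel]
    exact extChartAt_source_mem_nhds 1
  refine (h2.congr_of_eventuallyEq (h4.mono h3) (h3 x ?_)).congr_fderiv ?_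
  · rw [inv_mul_cancel]
    exact mem_extChartAt_source 1
  · ext v
    simp [infAct_apply hρ]

end Rep

/-! ### From phase space variations to reduced variations -/

section Variation

variable {E : Type*} [NormedAddCommGroup E] [NormedSpace ℝ E]
  {G : Type*} [TopologicalSpace G] [ChartedSpace E G] [Group G]
  {F F' : Type*} [NormedAddCommGroup F] [NormedSpace ℝ F]
  [NormedAddCommGroup F'] [NormedSpace ℝ F']
  [LieGroup 𝓘(ℝ, E) ∞ G] {t₀ t₁ r : ℝ}

theorem leftLogDeriv_comp {S : Set F} {T : Set F'} {g : F → G} {f : F' → F} {x : F'} {f' : F' →L[ℝ] F}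
    (hg : ContMDiffWithinAt 𝓘(ℝ, F) 𝓘(ℝ, E) ∞ g S (f x)) (hf : HasFDerivWithinAt f f' T x)
    (hm : MapsTo f T S) (hT : UniqueDiffWithinAt ℝ T x) :
    leftLogDeriv (E := E) T (fun y => g (f y)) x = (leftLogDeriv S g (f x)).comp f' := by
  have h1 : HasFDerivWithinAt (fun y => extChartAt 𝓘(ℝ, E) (1 : G) ((g (f x))⁻¹ * g y))
      (leftLogDeriv S g (f x)) S (f x) :=
    ((contDiffWithinAt_extChartAt_inv_mul hg).differentiableWithinAt (by simp)).hasFDerivWithinAt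
  exact (h1.comp x hf hm).fderivWithin hT

theorem bodyVelocity_eq_leftLogDeriv (ht : t₀ < t₁) {g : ℝ → G} {t : ℝ} (htm : t ∈ Icc t₀ t₁)
    (hg : ContMDiffWithinAt 𝓘(ℝ, ℝ) 𝓘(ℝ, E) ∞ g (Icc t₀ t₁) t) :
    bodyVelocity E t₀ t₁ g t = leftLogDeriv (Icc t₀ t₁) g t 1 :=
  tangentLeft_mfderivWithin (hg.mdifferentiableWithinAt (by simp)) (uniqueDiffOn_Icc ht t htm) 1

theorem uniqueDiffOn_strip (ht : t₀ < t₁) : UniqueDiffOn ℝ (Ioo (-r) r ×ˢ Icc t₀ t₁) :=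
  (isOpen_Ioo.uniqueDiffOn).prod (uniqueDiffOn_Icc ht)

/-- Supplies the symmetry of mixed partials on the strip, including at `t = t₀` and `t = t₁`. -/
theorem strip_subset_closure_interior (ht : t₀ < t₁) :
    Ioo (-r) r ×ˢ Icc t₀ t₁ ⊆ closure (interior (Ioo (-r) r ×ˢ Icc t₀ t₁)) := by
  rw [interior_prod_eq, isOpen_Ioo.interior_eq, interior_Icc, closure_prod_eq,
    closure_Ioo ht.ne]
  exact prod_mono subset_closure Subset.rfl

theorem hasFDerivWithinAt_horizontal (ε t : ℝ) (T : Set ℝ) :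
    HasFDerivWithinAt (fun e : ℝ => (e, t)) (ContinuousLinearMap.inl ℝ ℝ ℝ) T ε :=
  (hasFDerivAt_prodMk_left ε t).hasFDerivWithinAt

theorem hasFDerivWithinAt_vertical (ε t : ℝ) (T : Set ℝ) :
    HasFDerivWithinAt (fun s : ℝ => (ε, s)) (ContinuousLinearMap.inr ℝ ℝ ℝ) T t :=
  (hasFDerivAt_prodMk_right ε t).hasFDerivWithinAt

theorem hasDerivAt_horizontal {f : ℝ × ℝ → F} {f' : ℝ × ℝ →L[ℝ] F} {t : ℝ} (hr : 0 < r)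
    (ht : t ∈ Icc t₀ t₁) (hf : HasFDerivWithinAt f f' (Ioo (-r) r ×ˢ Icc t₀ t₁) (0, t)) :
    HasDerivAt (fun ε => f (ε, t)) (f' (1, 0)) 0 := by
  have h : HasFDerivWithinAt (fun ε => f (ε, t)) (f'.comp (ContinuousLinearMap.inl ℝ ℝ ℝ))
      (Ioo (-r) r) 0 :=
    HasFDerivWithinAt.comp (g := f) (0 : ℝ) hf (hasFDerivWithinAt_horizontal 0 t (Ioo (-r) r))
      (fun ε hε => ⟨hε, ht⟩)
  simpa using (h.hasFDerivAt (Ioo_mem_nhds (by linarith) hr)).hasDerivAt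

theorem hasDerivWithinAt_vertical {f : ℝ × ℝ → F} {f' : ℝ × ℝ →L[ℝ] F} {ε t : ℝ}
    (hε : ε ∈ Ioo (-r) r)
    (hf : HasFDerivWithinAt f f' (Ioo (-r) r ×ˢ Icc t₀ t₁) (ε, t)) :
    HasDerivWithinAt (fun s => f (ε, s)) (f' (0, 1)) (Icc t₀ t₁) t := by
  have h : HasFDerivWithinAt (fun s => f (ε, s)) (f'.comp (ContinuousLinearMap.inr ℝ ℝ ℝ))
      (Icc t₀ t₁) t :=
    HasFDerivWithinAt.comp (g := f) t hf (hasFDerivWithinAt_vertical ε t (Icc t₀ t₁))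
      (fun s hs => ⟨hε, hs⟩)
  simpa using h.hasDerivWithinAt

section Smooth

variable {g : ℝ × ℝ → G}
  (hg : ContMDiffOn 𝓘(ℝ, ℝ × ℝ) 𝓘(ℝ, E) ∞ g (Ioo (-r) r ×ˢ Icc t₀ t₁))

include hg

theorem bodyVelocity_vertical (ht : t₀ < t₁) {ε t : ℝ} (hε : ε ∈ Ioo (-r) r)
    (htm : t ∈ Icc t₀ t₁) :
    bodyVelocity E t₀ t₁ (fun s => g (ε, s)) t =
      leftLogDeriv (Ioo (-r) r ×ˢ Icc t₀ t₁) g (ε, t) (0, 1) := by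
  have hmaps : MapsTo (fun s : ℝ => (ε, s)) (Icc t₀ t₁) (Ioo (-r) r ×ˢ Icc t₀ t₁) :=
    fun s hs => ⟨hε, hs⟩
  have h1 : ContMDiffWithinAt 𝓘(ℝ, ℝ) 𝓘(ℝ, E) ∞ (fun s => g (ε, s)) (Icc t₀ t₁) t :=
    (hg (ε, t) ⟨hε, htm⟩).comp t
      (contDiff_prodMk_right ε).contMDiff.contMDiffAt.contMDiffWithinAt hmaps
  rw [bodyVelocity_eq_leftLogDeriv ht htm h1, leftLogDeriv_comp (hg (ε, t) ⟨hε, htm⟩)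
    (hasFDerivWithinAt_vertical ε t _) hmaps (uniqueDiffOn_Icc ht t htm)]
  simp

theorem leftLogDeriv_horizontal {t : ℝ} (hr : 0 < r) (htm : t ∈ Icc t₀ t₁) :
    leftLogDeriv (E := E) (Ioo (-r) r ×ˢ Icc t₀ t₁) g (0, t) (1, 0) =
      leftLogDeriv (Ioo (-r) r) (fun ε => g (ε, t)) 0 (1 : ℝ) := by
  have h0 : (0 : ℝ) ∈ Ioo (-r) r := ⟨by linarith, hr⟩
  have hmaps : MapsTo (fun ε : ℝ => (ε, t)) (Ioo (-r) r) (Ioo (-r) r ×ˢ Icc t₀ t₁) :=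
    fun s hs => ⟨hs, htm⟩
  rw [leftLogDeriv_comp (f := fun ε : ℝ => (ε, t)) (x := 0) (hg (0, t) ⟨h0, htm⟩)
    (hasFDerivWithinAt_horizontal 0 t _) hmaps (isOpen_Ioo.uniqueDiffWithinAt h0)]
  simp

theorem leftLogDeriv_horizontal_eq_zero {t : ℝ} (hr : 0 < r) (htm : t ∈ Icc t₀ t₁)
    (h : mfderiv 𝓘(ℝ, ℝ) 𝓘(ℝ, E) (fun ε => g (ε, t)) 0 = 0) :
    leftLogDeriv (E := E) (Ioo (-r) r ×ˢ Icc t₀ t₁) g (0, t) (1, 0) = 0 := by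
  have h0 : (0 : ℝ) ∈ Ioo (-r) r := ⟨by linarith, hr⟩
  have hmaps : MapsTo (fun ε : ℝ => (ε, t)) (Ioo (-r) r) (Ioo (-r) r ×ˢ Icc t₀ t₁) :=
    fun s hs => ⟨hs, htm⟩
  have h1 : ContMDiffWithinAt 𝓘(ℝ, ℝ) 𝓘(ℝ, E) ∞ (fun ε => g (ε, t)) (Ioo (-r) r) 0 :=
    (hg (0, t) ⟨h0, htm⟩).comp 0
      (contDiff_prodMk_left t).contMDiff.contMDiffAt.contMDiffWithinAt hmaps
  rw [leftLogDeriv_horizontal hg hr htm, ← tangentLeft_mfderivWithin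
    (h1.mdifferentiableWithinAt (by simp)) (isOpen_Ioo.uniqueDiffWithinAt h0) 1]
  have h2 : mfderivWithin 𝓘(ℝ, ℝ) 𝓘(ℝ, E) (fun ε => g (ε, t)) (Ioo (-r) r) 0 = 0 := by
    rw [mfderivWithin_of_mem_nhds (isOpen_Ioo.mem_nhds h0), h]
  refine (congrArg (fun A : ℝ →L[ℝ] E => tangentLeft E (g (0, t))⁻¹ (g (0, t)) (A 1)) h2).trans ?_
  exact map_zero _

end Smooth

variable [FiniteDimensional ℝ E]
  {V : Type*} [NormedAddCommGroup V] [NormedSpace ℝ V] [FiniteDimensional ℝ V]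
  {ρ : Representation ℝ G V} {α : ℝ → CotangentBundle E G} {Γ : ℝ → ℝ → CotangentBundle E G}

omit [LieGroup 𝓘(ℝ, E) ∞ G] [FiniteDimensional ℝ E] in
theorem bodyVelocity_congr {g g' : ℝ → G} {t : ℝ} (h : ∀ s ∈ Icc t₀ t₁, g s = g' s)
    (ht : t ∈ Icc t₀ t₁) : bodyVelocity E t₀ t₁ g t = bodyVelocity E t₀ t₁ g' t := by
  have hv : velocity E t₀ t₁ g t = velocity E t₀ t₁ g' t :=
    congrArg (fun A : ℝ →L[ℝ] E => A 1)
      (mfderivWithin_congr (I := 𝓘(ℝ, ℝ)) (I' := 𝓘(ℝ, E)) h (h t ht))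
  rw [bodyVelocity, bodyVelocity, hv, h t ht]

/-- On the strip take `η = ω(∂_ε)` at `ε = 0` and `ξ_ε = ω(∂_t)`, where `ω = g⁻¹ dg`. The constraint
on `δξ` is the structure equation evaluated on `∂_ε, ∂_t`, and `η` vanishes at the endpoints because
`δg` does. -/
theorem IsPhaseVariation.isReducedVariation
    (hρ : ContMDiff (𝓘(ℝ, E).prod 𝓘(ℝ, V)) 𝓘(ℝ, V) ∞ (fun x : G × V => ρ x.1 x.2))
    (a₀ : V →L[ℝ] ℝ) (ht : t₀ < t₁) (hΓ : IsPhaseVariation t₀ t₁ r α Γ) :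
    IsReducedVariation (E := E) ρ t₀ t₁ r (fun t => bodyMomentum (α t))
      (fun t => bodyVelocity E t₀ t₁ (fun s => (α s).1) t)
      (fun t => dualAct ρ ((α t).1)⁻¹ a₀)
      (fun t => leftLogDeriv (Ioo (-r) r ×ˢ Icc t₀ t₁) (fun x : ℝ × ℝ => (Γ x.1 x.2).1) (0, t) (1, 0))
      (fun ε t => bodyMomentum (Γ ε t))
      (fun ε t =>
        leftLogDeriv (Ioo (-r) r ×ˢ Icc t₀ t₁) (fun x : ℝ × ℝ => (Γ x.1 x.2).1) (ε, t) (0, 1))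
      (fun ε t => dualAct ρ ((Γ ε t).1)⁻¹ a₀) := by
  have hr := hΓ.pos
  have h0 : (0 : ℝ) ∈ Ioo (-r) r := ⟨by linarith, hr⟩
  set S := Ioo (-r) r ×ˢ Icc t₀ t₁ with hS
  set g : ℝ × ℝ → G := fun x => (Γ x.1 x.2).1 with hgdef
  have hU : UniqueDiffOn ℝ S := uniqueDiffOn_strip ht
  have hsm := fun x hx => contMDiffWithinAt_cotangent_iff.1 (hΓ.smooth x hx)
  have hg : ContMDiffOn 𝓘(ℝ, ℝ × ℝ) 𝓘(ℝ, E) ∞ g S := fun x hx => (hsm x hx).1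
  have hω : ContDiffOn ℝ ∞ (leftLogDeriv (E := E) S g) S :=
    fun x hx => contDiffWithinAt_leftLogDeriv (hg x hx) hU hx
  have hωd : ∀ x ∈ S, HasFDerivWithinAt (leftLogDeriv (E := E) S g)
      (fderivWithin ℝ (leftLogDeriv (E := E) S g) S x) S x := fun x hx =>
    ((hω x hx).differentiableWithinAt (by simp)).hasFDerivWithinAt
  have hev : ∀ w, ∀ x ∈ S, HasFDerivWithinAt (fun y => leftLogDeriv (E := E) S g y w)
      ((fderivWithin ℝ (leftLogDeriv (E := E) S g) S x).flip w) S x := fun w x hx => by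
    have := (hωd x hx).clm_apply (hasFDerivWithinAt_const w x S)
    simpa using this
  have hηd : ∀ t ∈ Icc t₀ t₁, HasDerivWithinAt (fun t => leftLogDeriv (E := E) S g (0, t) (1, 0))
      (fderivWithin ℝ (leftLogDeriv (E := E) S g) S (0, t) (0, 1) (1, 0)) (Icc t₀ t₁) t :=
    fun t htm => hasDerivWithinAt_vertical h0 (hev (1, 0) (0, t) ⟨h0, htm⟩)
  refine ⟨hr, fun x hx => (hsm x hx).2, ?_, ?_, ?_, ?_, ?_, ?_, ?_, ?_, ?_, ?_⟩
  · exact hω.clm_apply contDiffOn_const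
  · exact fun x hx => contDiffWithinAt_dualAct_inv hρ (hg x hx) a₀
  · exact (hω.comp (contDiff_prodMk_right (0 : ℝ)).contDiffOn
      (fun t htm => ⟨h0, htm⟩)).clm_apply contDiffOn_const
  · exact fun t htm => by rw [hΓ.base t htm]
  · intro t htm
    rw [← bodyVelocity_vertical hg ht h0 htm]
    exact bodyVelocity_congr (fun s hs => by simp only [hgdef]; rw [hΓ.base s hs]) htm
  · exact fun t htm => by rw [hΓ.base t htm]
  · exact leftLogDeriv_horizontal_eq_zero hg hr (left_mem_Icc.2 ht.le) hΓ.left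
  · exact leftLogDeriv_horizontal_eq_zero hg hr (right_mem_Icc.2 ht.le) hΓ.right
  · intro t htm
    have hx : ((0 : ℝ), t) ∈ S := ⟨h0, htm⟩
    have h1 := hasDerivAt_horizontal hr htm (hev (0, 1) (0, t) hx)
    have h2 := fderivWithin_leftLogDeriv_sub (hg _ hx) hU hx (strip_subset_closure_interior ht hx)
      (1, 0) (0, 1)
    have h3 : bodyVelocity E t₀ t₁ (fun s => (α s).1) t = leftLogDeriv S g (0, t) (0, 1) := by
      rw [← bodyVelocity_vertical hg ht h0 htm]
      exact bodyVelocity_congr (fun s hs => by simp only [hgdef]; rw [hΓ.base s hs]) htm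
    rw [(hηd t htm).derivWithin (uniqueDiffOn_Icc ht t htm), h3, ← h2]
    simpa using h1
  · intro t htm
    have hx : ((0 : ℝ), t) ∈ S := ⟨h0, htm⟩
    have h1 := hasDerivAt_horizontal hr htm (hasFDerivWithinAt_dualAct_inv hρ (hg _ hx) a₀)
    simp only [hgdef] at h1
    rw [hΓ.base t htm] at h1
    exact h1

/-- The phase space action of a variation equals its reduced action. -/
theorem IsPhaseVariation.phaseAction_eq {H : CotangentBundle E G × (V →L[ℝ] ℝ) → ℝ}
    (hinv : IsLeftInvariant ρ H) (a₀ : V →L[ℝ] ℝ) (ht : t₀ < t₁)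
    (hΓ : IsPhaseVariation t₀ t₁ r α Γ) {ε : ℝ} (hε : ε ∈ Ioo (-r) r) :
    phaseAction t₀ t₁ (fun β => H (β, a₀)) (Γ ε) =
      reducedAction t₀ t₁ (reducedHamiltonian H) (fun t => bodyMomentum (Γ ε t))
        (fun t =>
          leftLogDeriv (Ioo (-r) r ×ˢ Icc t₀ t₁) (fun x : ℝ × ℝ => (Γ x.1 x.2).1) (ε, t) (0, 1))
        (fun t => dualAct ρ ((Γ ε t).1)⁻¹ a₀) := by
  have hg : ContMDiffOn 𝓘(ℝ, ℝ × ℝ) 𝓘(ℝ, E) ∞ (fun x : ℝ × ℝ => (Γ x.1 x.2).1)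
      (Ioo (-r) r ×ˢ Icc t₀ t₁) :=
    fun x hx => (contMDiffWithinAt_cotangent_iff.1 (hΓ.smooth x hx)).1
  refine intervalIntegral.integral_congr fun t htm => ?_
  rw [uIcc_of_le ht.le] at htm
  simp only
  rw [covector_eq_bodyMomentum_comp, hinv.eq_reducedHamiltonian,
    ← bodyVelocity_vertical hg ht hε htm]
  rfl

end Variation

/-! ### Realizing arbitrary `(η, δμ)` by a phase space variation -/

section Realize

variable {E : Type*} [NormedAddCommGroup E] [NormedSpace ℝ E]
  {G : Type*} [TopologicalSpace G] [ChartedSpace E G] [Group G]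
  [LieGroup 𝓘(ℝ, E) ∞ G] {t₀ t₁ : ℝ}

/-- The variation of `α` in the directions `η` and `δμ` of the left trivialization of `T*G`. -/
def trivializedVariation (α : ℝ → CotangentBundle E G) (η : ℝ → E) (δμ : ℝ → E →L[ℝ] ℝ) (ε t : ℝ) :
    CotangentBundle E G :=
  ofBody ((α t).1 * (extChartAt 𝓘(ℝ, E) (1 : G)).symm
    (extChartAt 𝓘(ℝ, E) (1 : G) 1 + ε • η t)) (bodyMomentum (α t) + ε • δμ t)

/-- Compactness of `[t₀, t₁]` bounds `η`, so one `r` keeps the perturbation inside the chart domain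
for all times. -/
theorem exists_mem_target (G : Type*) [TopologicalSpace G] [ChartedSpace E G] [Group G]
    {η : ℝ → E} (hη : ContinuousOn η (Icc t₀ t₁)) :
    ∃ r : ℝ, 0 < r ∧ ∀ ε ∈ Ioo (-r) r, ∀ t ∈ Icc t₀ t₁,
      extChartAt 𝓘(ℝ, E) (1 : G) 1 + ε • η t ∈ (extChartAt 𝓘(ℝ, E) (1 : G)).target := by
  obtain ⟨C, hC⟩ := isCompact_Icc.exists_bound_of_continuousOn hη
  obtain ⟨δ, hδ, hball⟩ := Metric.isOpen_iff.1 (isOpen_extChartAt_target (I := 𝓘(ℝ, E)) (1 : G)) _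
    (mem_extChartAt_target 1)
  have hC' : 0 < |C| + 1 := by positivity
  refine ⟨δ / (|C| + 1), by positivity, fun ε hε t htm => hball ?_⟩
  rw [Metric.mem_ball, dist_eq_norm, add_sub_cancel_left, norm_smul, Real.norm_eq_abs]
  have h1 : |ε| < δ / (|C| + 1) := abs_lt.2 hε
  have h2 : ‖η t‖ ≤ |C| := (hC t htm).trans (le_abs_self C)
  calc |ε| * ‖η t‖ ≤ |ε| * (|C| + 1) := by gcongr; linarith
    _ < δ / (|C| + 1) * (|C| + 1) := by gcongr
    _ = δ := by field_simp

variable [FiniteDimensional ℝ E] {α : ℝ → CotangentBundle E G} {η : ℝ → E} {δμ : ℝ → E →L[ℝ] ℝ}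

/-- Multiplying `g` on the right by the point with coordinates `φ(1) + ε η` plays the role of `g
exp(εη)` to first order, and the chart at `1` makes its logarithmic derivative at `ε = 0` exactly
`η`. The momentum is moved independently, in the left trivialization. -/
theorem exists_isPhaseVariation
    (hα : ContMDiffOn 𝓘(ℝ, ℝ) (cotangentModel E) ∞ α (Icc t₀ t₁))
    (hη : ContDiffOn ℝ ∞ η (Icc t₀ t₁)) (hδμ : ContDiffOn ℝ ∞ δμ (Icc t₀ t₁))
    (h₀ : η t₀ = 0) (h₁ : η t₁ = 0) :
    ∃ r, IsPhaseVariation t₀ t₁ r α (trivializedVariation α η δμ) ∧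
      ∀ t ∈ Icc t₀ t₁, HasDerivAt (fun ε => bodyMomentum (trivializedVariation α η δμ ε t))
          (δμ t) 0 ∧
        leftLogDeriv (Ioo (-r) r ×ˢ Icc t₀ t₁)
          (fun x : ℝ × ℝ => (trivializedVariation α η δμ x.1 x.2).1) (0, t) (1, 0) = η t := by
  obtain ⟨r, hr, hmem⟩ := exists_mem_target G hη.continuousOn
  set φ := extChartAt 𝓘(ℝ, E) (1 : G) with hφ
  have h0 : (0 : ℝ) ∈ Ioo (-r) r := ⟨by linarith, hr⟩
  have hα' := fun t htm => contMDiffWithinAt_cotangent_iff.1 (hα t htm)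
  have hcst : ∀ t, η t = 0 → mfderiv 𝓘(ℝ, ℝ) 𝓘(ℝ, E)
      (fun ε => (trivializedVariation α η δμ ε t).1) 0 = 0 := by
    intro t h
    have : (fun ε => (trivializedVariation α η δμ ε t).1) = fun _ => (α t).1 := by
      ext1 ε
      simp only [trivializedVariation, ofBody_fst, h, smul_zero, add_zero]
      rw [extChartAt_to_inv, mul_one]
    rw [this]
    exact mfderiv_const
  have hsm : ContMDiffOn 𝓘(ℝ, ℝ × ℝ) (cotangentModel E) ∞
      (fun x : ℝ × ℝ => trivializedVariation α η δμ x.1 x.2) (Ioo (-r) r ×ˢ Icc t₀ t₁) := by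
    intro x hx
    have hsnd : ContDiffWithinAt ℝ ∞ (Prod.snd : ℝ × ℝ → ℝ) (Ioo (-r) r ×ˢ Icc t₀ t₁) x :=
      contDiffWithinAt_snd
    have hfst : ContDiffWithinAt ℝ ∞ (Prod.fst : ℝ × ℝ → ℝ) (Ioo (-r) r ×ˢ Icc t₀ t₁) x :=
      contDiffWithinAt_fst
    have hm : MapsTo (Prod.snd : ℝ × ℝ → ℝ) (Ioo (-r) r ×ˢ Icc t₀ t₁) (Icc t₀ t₁) :=
      fun y hy => hy.2
    rw [contMDiffWithinAt_cotangent_iff]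
    simp only [trivializedVariation, ofBody_fst, bodyMomentum_ofBody]
    constructor
    · refine ContMDiffWithinAt.mul (I := 𝓘(ℝ, E)) ?_ ?_
      · exact (hα' x.2 hx.2).1.comp x hsnd.contMDiffWithinAt hm
      · have h1 : ContDiffWithinAt ℝ ∞ (fun y : ℝ × ℝ => φ 1 + y.1 • η y.2)
            (Ioo (-r) r ×ˢ Icc t₀ t₁) x :=
          contDiffWithinAt_const.add (hfst.smul ((hη x.2 hx.2).comp x hsnd hm))
        exact ContMDiffAt.comp_contMDiffWithinAt (g := φ.symm) x
          (contMDiffAt_extChartAt_symm (hmem _ hx.1 _ hx.2)) h1.contMDiffWithinAt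
    · exact ((hα' x.2 hx.2).2.comp x hsnd hm).add (hfst.smul ((hδμ x.2 hx.2).comp x hsnd hm))
  refine ⟨r, ⟨hr, hsm, ?_, hcst _ h₀, hcst _ h₁⟩, fun t htm => ⟨?_, ?_⟩⟩
  · intro t htm
    simp only [trivializedVariation, zero_smul, add_zero]
    rw [extChartAt_to_inv, mul_one, ofBody_bodyMomentum]
  · simp only [trivializedVariation, bodyMomentum_ofBody]
    simpa using ((hasDerivAt_id (0 : ℝ)).smul_const (δμ t)).const_add (bodyMomentum (α t))
  · have hg := fun x hx => (contMDiffWithinAt_cotangent_iff.1 (hsm x hx)).1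
    rw [leftLogDeriv_horizontal hg hr htm, leftLogDeriv]
    have h1 : HasDerivWithinAt (fun ε : ℝ => φ 1 + ε • η t) (η t) (Ioo (-r) r) 0 := by
      simpa using (((hasDerivAt_id (0 : ℝ)).smul_const (η t)).const_add (φ 1)).hasDerivWithinAt
    have h2 : ∀ ε ∈ Ioo (-r) r, φ ((trivializedVariation α η δμ 0 t).1⁻¹ *
        (trivializedVariation α η δμ ε t).1) = φ 1 + ε • η t := by
      intro ε hε
      simp only [trivializedVariation, ofBody_fst, zero_smul, add_zero]
      rw [extChartAt_to_inv, mul_one, inv_mul_cancel_left]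
      exact φ.right_inv (hmem ε hε t htm)
    rw [fderivWithin_congr h2 (h2 0 h0)]
    have := h1.derivWithin (isOpen_Ioo.uniqueDiffWithinAt h0)
    rwa [← fderivWithin_derivWithin] at this

end Realize

/-! ### Differentiation under the integral and the fundamental lemma -/

section Calculus

variable {t₀ t₁ r : ℝ} {E : Type*} [NormedAddCommGroup E] [NormedSpace ℝ E]

theorem hasDerivAt_intervalIntegral_of_contDiffOn {f : ℝ × ℝ → ℝ} {f' : ℝ → ℝ} (hr : 0 < r)
    (ht : t₀ < t₁) (hf : ContDiffOn ℝ ∞ f (Ioo (-r) r ×ˢ Icc t₀ t₁))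
    (hf' : ∀ t ∈ Icc t₀ t₁, HasDerivAt (fun ε => f (ε, t)) (f' t) 0) :
    HasDerivAt (fun ε => ∫ t in t₀..t₁, f (ε, t)) (∫ t in t₀..t₁, f' t) 0 := by
  set S := Ioo (-r) r ×ˢ Icc t₀ t₁ with hS
  have hU : UniqueDiffOn ℝ S := uniqueDiffOn_strip ht
  have hd : ∀ ε ∈ Ioo (-r) r, ∀ t ∈ Icc t₀ t₁,
      HasDerivAt (fun ε => f (ε, t)) (fderivWithin ℝ f S (ε, t) (1, 0)) ε := by
    intro ε hε t htm
    have h1 : HasFDerivWithinAt f (fderivWithin ℝ f S (ε, t)) S (ε, t) :=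
      ((hf (ε, t) ⟨hε, htm⟩).differentiableWithinAt (by simp)).hasFDerivWithinAt
    have h2 : HasFDerivWithinAt (fun ε => f (ε, t))
        ((fderivWithin ℝ f S (ε, t)).comp (ContinuousLinearMap.inl ℝ ℝ ℝ)) (Ioo (-r) r) ε :=
      HasFDerivWithinAt.comp (g := f) ε h1 (hasFDerivWithinAt_horizontal ε t (Ioo (-r) r))
        (fun ε hε => ⟨hε, htm⟩)
    simpa using (h2.hasFDerivAt (isOpen_Ioo.mem_nhds hε)).hasDerivAt
  have hc : ContinuousOn (fun x => fderivWithin ℝ f S x (1, 0)) S :=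
    (hf.continuousOn_fderivWithin hU (by simp)).clm_apply continuousOn_const
  -- Halving `r` gives a compact strip, on which the `ε`-derivative has a constant bound for
  -- dominated convergence.
  have hsub : Icc (-(r / 2)) (r / 2) ×ˢ Icc t₀ t₁ ⊆ S :=
    prod_mono (fun ε hε => ⟨by linarith [hε.1], by linarith [hε.2]⟩) Subset.rfl
  obtain ⟨C, hC⟩ := (isCompact_Icc.prod isCompact_Icc).exists_bound_of_continuousOn
    (hc.mono hsub)
  have h0 : (0 : ℝ) ∈ Ioo (-r) r := ⟨by linarith, hr⟩
  have hslice : ∀ ε ∈ Ioo (-r) r, ∀ {k : ℝ × ℝ → ℝ}, ContinuousOn k S →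
      IntervalIntegrable (fun t => k (ε, t)) MeasureTheory.volume t₀ t₁ := by
    intro ε hε k hk
    refine ContinuousOn.intervalIntegrable ?_
    rw [uIcc_of_le ht.le]
    exact hk.comp (Continuous.prodMk_right ε).continuousOn fun t htm => ⟨hε, htm⟩
  have key := intervalIntegral.hasDerivAt_integral_of_dominated_loc_of_deriv_le
    (μ := MeasureTheory.volume) (a := t₀) (b := t₁) (bound := fun _ => C)
    (F := fun ε t => f (ε, t)) (F' := fun ε t => fderivWithin ℝ f S (ε, t) (1, 0))
    (s := Ioo (-(r / 2)) (r / 2)) (x₀ := 0)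
    (Ioo_mem_nhds (by linarith) (by linarith)) ?_ (hslice 0 h0 hf.continuousOn)
    (intervalIntegrable_iff.1 (hslice 0 h0 hc)).aestronglyMeasurable ?_ intervalIntegrable_const ?_
  · have h2 := key.2
    rwa [intervalIntegral.integral_congr (g := f')] at h2
    intro t htm
    rw [uIcc_of_le ht.le] at htm
    exact (hd 0 h0 t htm).unique (hf' t htm)
  · filter_upwards [Ioo_mem_nhds h0.1 h0.2] with ε hε
    exact (intervalIntegrable_iff.1 (hslice ε hε hf.continuousOn)).aestronglyMeasurable
  · refine Filter.Eventually.of_forall fun t htm ε hε => ?_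
    rw [uIoc_of_le ht.le] at htm
    exact hC (ε, t) ⟨Ioo_subset_Icc_self hε, Ioc_subset_Icc_self htm⟩
  · refine Filter.Eventually.of_forall fun t htm ε hε => ?_
    rw [uIoc_of_le ht.le] at htm
    exact hd ε ⟨by linarith [hε.1], by linarith [hε.2]⟩ t (Ioc_subset_Icc_self htm)

theorem eq_zero_of_integral_eq_zero {f : ℝ → ℝ} (ht : t₀ < t₁) (hf : ContinuousOn f (Icc t₀ t₁))
    (h0 : ∀ t ∈ Icc t₀ t₁, 0 ≤ f t) (hi : ∫ t in t₀..t₁, f t = 0) :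
    ∀ t ∈ Icc t₀ t₁, f t = 0 := by
  intro t htm
  by_contra hne
  exact (intervalIntegral.integral_pos ht hf (fun s hs => h0 s (Ioc_subset_Icc_self hs))
    ⟨t, htm, lt_of_le_of_ne (h0 t htm) (Ne.symm hne)⟩).ne' hi

variable {μ : ℝ → E →L[ℝ] ℝ} {w : ℝ → E} {N : ℝ → E →L[ℝ] ℝ} {η : ℝ → E}

theorem hasDerivWithinAt_pairing (hμ : ContDiffOn ℝ ∞ μ (Icc t₀ t₁))
    (hη : ContDiffOn ℝ ∞ η (Icc t₀ t₁)) {t : ℝ} (htm : t ∈ Icc t₀ t₁) :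
    HasDerivWithinAt (fun t => μ t (η t))
      (derivWithin μ (Icc t₀ t₁) t (η t) + μ t (derivWithin η (Icc t₀ t₁) t)) (Icc t₀ t₁) t :=
  ((hμ t htm).differentiableWithinAt (by simp)).hasDerivWithinAt.clm_apply
    ((hη t htm).differentiableWithinAt (by simp)).hasDerivWithinAt

theorem integral_pairing_eq_zero (ht : t₀ < t₁) (hμ : ContDiffOn ℝ ∞ μ (Icc t₀ t₁))
    (hη : ContDiffOn ℝ ∞ η (Icc t₀ t₁)) (h₀ : η t₀ = 0) (h₁ : η t₁ = 0) :
    ∫ t in t₀..t₁,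
      (derivWithin μ (Icc t₀ t₁) t (η t) + μ t (derivWithin η (Icc t₀ t₁) t)) = 0 := by
  have hU := uniqueDiffOn_Icc ht
  have h := intervalIntegral.integral_eq_sub_of_hasDerivAt_of_le ht.le
    (hμ.continuousOn.clm_apply hη.continuousOn)
    (fun t htm => (hasDerivWithinAt_pairing hμ hη (Ioo_subset_Icc_self htm)).hasDerivAt
      (Icc_mem_nhds htm.1 htm.2)) ?_
  · rw [h, h₀, h₁, map_zero, map_zero, sub_zero]
  · refine ContinuousOn.intervalIntegrable ?_
    rw [uIcc_of_le ht.le]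
    exact ((hμ.continuousOn_derivWithin hU (by simp)).clm_apply hη.continuousOn).add
      (hμ.continuousOn.clm_apply (hη.continuousOn_derivWithin hU (by simp)))

/-- The fundamental lemma of the calculus of variations for the functional
`(η, δμ) ↦ ∫ (⟨δμ, w⟩ + ⟨μ, η'⟩ + ⟨N, η⟩)`. -/
theorem eq_zero_and_derivWithin_eq_of_forall_integral_eq_zero (ht : t₀ < t₁)
    (hμ : ContDiffOn ℝ ∞ μ (Icc t₀ t₁))
    (hw : ∀ y : E →L[ℝ] ℝ, ContDiffOn ℝ ∞ (fun t => y (w t)) (Icc t₀ t₁))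
    (hN : ∀ v : E, ContDiffOn ℝ ∞ (fun t => N t v) (Icc t₀ t₁))
    (h : ∀ (η : ℝ → E) (δμ : ℝ → E →L[ℝ] ℝ), ContDiffOn ℝ ∞ η (Icc t₀ t₁) →
      ContDiffOn ℝ ∞ δμ (Icc t₀ t₁) → η t₀ = 0 → η t₁ = 0 →
      ∫ t in t₀..t₁, (δμ t (w t) + μ t (derivWithin η (Icc t₀ t₁) t) + N t (η t)) = 0) :
    ∀ t ∈ Icc t₀ t₁, w t = 0 ∧ derivWithin μ (Icc t₀ t₁) t = N t := by
  have hU := uniqueDiffOn_Icc ht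
  have hμ' : ContDiffOn ℝ ∞ (derivWithin μ (Icc t₀ t₁)) (Icc t₀ t₁) :=
    hμ.derivWithin hU (by simp)
  have h1 : ∀ t ∈ Icc t₀ t₁, w t = 0 := by
    intro t htm
    refine SeparatingDual.eq_zero_of_forall_dual_eq_zero (R := ℝ) fun y => ?_
    -- With `η = 0` and this `δμ`, the integrand becomes the square of `y (w t)`.
    have h2 := h 0 (fun t => y (w t) • y) contDiffOn_const ((hw y).smul contDiffOn_const) rfl rfl
    simp only [Pi.zero_apply, map_zero, add_zero, smul_apply,
      smul_eq_mul] at h2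
    have h3 : derivWithin (0 : ℝ → E) (Icc t₀ t₁) = 0 := by
      ext s
      exact congrFun (derivWithin_const (Icc t₀ t₁) (0 : E)) s
    simp only [h3, Pi.zero_apply, map_zero, add_zero] at h2
    have h4 := eq_zero_of_integral_eq_zero ht
      ((hw y).continuousOn.mul (hw y).continuousOn) (fun s _ => mul_self_nonneg _) h2 t htm
    exact mul_self_eq_zero.1 h4
  have h2 : ∀ v : E, ∀ t ∈ Icc t₀ t₁, N t v - derivWithin μ (Icc t₀ t₁) t v = 0 := by
    intro v
    set f : ℝ → ℝ := fun t => N t v - derivWithin μ (Icc t₀ t₁) t v with hf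
    have hfs : ContDiffOn ℝ ∞ f (Icc t₀ t₁) := (hN v).sub (hμ'.clm_apply contDiffOn_const)
    -- The data being smooth, no bump function is needed: this weight vanishes at the endpoints and
    -- is positive between them. With `η = b f v`, integration by parts turns the integrand into `b
    -- f²`.
    set b : ℝ → ℝ := fun t => (t - t₀) * (t₁ - t) with hb
    have hbs : ContDiff ℝ ∞ b := by fun_prop
    set η : ℝ → E := fun t => (b t * f t) • v with hηdef
    have hη : ContDiffOn ℝ ∞ η (Icc t₀ t₁) := (hbs.contDiffOn.mul hfs).smul contDiffOn_const
    have hη₀ : η t₀ = 0 := by simp [hηdef, hb]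
    have hη₁ : η t₁ = 0 := by simp [hηdef, hb]
    have e1 := h η 0 hη contDiffOn_const hη₀ hη₁
    have e2 := integral_pairing_eq_zero ht hμ hη hη₀ hη₁
    have hNη : ContinuousOn (fun t => N t (η t)) (Icc t₀ t₁) := by
      simp only [hηdef, map_smul, smul_eq_mul]
      exact (hbs.continuous.continuousOn.mul hfs.continuousOn).mul (hN v).continuousOn
    have hμη : ContinuousOn (fun t => μ t (derivWithin η (Icc t₀ t₁) t)) (Icc t₀ t₁) :=
      hμ.continuousOn.clm_apply (hη.continuousOn_derivWithin hU (by simp))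
    have hμη' : ContinuousOn (fun t => derivWithin μ (Icc t₀ t₁) t (η t)) (Icc t₀ t₁) :=
      hμ'.continuousOn.clm_apply hη.continuousOn
    have e3 : ∫ t in t₀..t₁, b t * (f t * f t) = 0 := by
      have e4 : ∫ t in t₀..t₁, (((0 : ℝ → E →L[ℝ] ℝ) t (w t) +
          μ t (derivWithin η (Icc t₀ t₁) t) + N t (η t)) -
          (derivWithin μ (Icc t₀ t₁) t (η t) + μ t (derivWithin η (Icc t₀ t₁) t))) = 0 := by
        rw [intervalIntegral.integral_sub, e1, e2, sub_zero]
        · refine ContinuousOn.intervalIntegrable ?_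
          rw [uIcc_of_le ht.le]
          simp only [Pi.zero_apply, zero_apply, zero_add]
          exact hμη.add hNη
        · refine ContinuousOn.intervalIntegrable ?_
          rw [uIcc_of_le ht.le]
          exact hμη'.add hμη
      rw [← e4]
      refine intervalIntegral.integral_congr fun t _ => ?_
      simp only [hηdef, map_smul, smul_eq_mul, hf, Pi.zero_apply, zero_apply]
      ring
    have e5 := eq_zero_of_integral_eq_zero ht
      (hbs.continuous.continuousOn.mul (hfs.continuousOn.mul hfs.continuousOn))
      (fun t htm => mul_nonneg (mul_nonneg (by linarith [htm.1]) (by linarith [htm.2]))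
        (mul_self_nonneg _)) e3
    have e6 : EqOn f 0 (Ioo t₀ t₁) := by
      intro t htm
      have hbt : b t ≠ 0 := (mul_pos (by linarith [htm.1]) (by linarith [htm.2])).ne'
      exact mul_self_eq_zero.1 ((mul_eq_zero.1 (e5 t (Ioo_subset_Icc_self htm))).resolve_left hbt)
    -- The weight gives no information at the endpoints; continuity of `f` does.
    have e7 : EqOn f 0 (Icc t₀ t₁) := by
      refine e6.of_subset_closure hfs.continuousOn continuousOn_const Ioo_subset_Icc_self ?_
      rw [closure_Ioo ht.ne]
    exact e7
  refine fun t htm => ⟨h1 t htm, ?_⟩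
  ext v
  exact (sub_eq_zero.1 (h2 v t htm)).symm

end Calculus

/-! ### First variation of the reduced action -/

section Reduced

variable {E : Type*} [NormedAddCommGroup E] [NormedSpace ℝ E] [FiniteDimensional ℝ E]
  {G : Type*} [TopologicalSpace G] [ChartedSpace E G] [Group G]
  [LieGroup 𝓘(ℝ, E) ∞ G]
  {V : Type*} [NormedAddCommGroup V] [NormedSpace ℝ V] [FiniteDimensional ℝ V]
  {ρ : Representation ℝ G V} {t₀ t₁ r : ℝ}
  {h : (E →L[ℝ] ℝ) → (V →L[ℝ] ℝ) → ℝ}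

omit [FiniteDimensional ℝ E] [LieGroup 𝓘(ℝ, E) ∞ G] in
theorem neg_diamond_apply (b : V) (a : V →L[ℝ] ℝ) (η : E) :
    -(diamond E ρ b a η) = infAct E ρ a η b := by
  simp [diamond]

omit [FiniteDimensional ℝ E] [FiniteDimensional ℝ V] in
theorem hasFDerivAt_left (hh : ContDiff ℝ ∞ (fun z : (E →L[ℝ] ℝ) × (V →L[ℝ] ℝ) => h z.1 z.2))
    (μ : E →L[ℝ] ℝ) (a : V →L[ℝ] ℝ) :
    HasFDerivAt (fun m => h m a) ((fderiv ℝ (fun z : (E →L[ℝ] ℝ) × (V →L[ℝ] ℝ) => h z.1 z.2)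
      (μ, a)).comp (ContinuousLinearMap.inl ℝ _ _)) μ :=
  HasFDerivAt.comp (f := fun m => (m, a)) μ
    (hh.differentiable (by simp) (μ, a)).hasFDerivAt (hasFDerivAt_prodMk_left μ a)

omit [FiniteDimensional ℝ E] [FiniteDimensional ℝ V] in
theorem hasFDerivAt_right (hh : ContDiff ℝ ∞ (fun z : (E →L[ℝ] ℝ) × (V →L[ℝ] ℝ) => h z.1 z.2))
    (μ : E →L[ℝ] ℝ) (a : V →L[ℝ] ℝ) :
    HasFDerivAt (fun b => h μ b) ((fderiv ℝ (fun z : (E →L[ℝ] ℝ) × (V →L[ℝ] ℝ) => h z.1 z.2)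
      (μ, a)).comp (ContinuousLinearMap.inr ℝ _ _)) a :=
  HasFDerivAt.comp (f := fun b => (μ, b)) a
    (hh.differentiable (by simp) (μ, a)).hasFDerivAt (hasFDerivAt_prodMk_right μ a)

theorem fderiv_eq_varDeriv (hh : ContDiff ℝ ∞ (fun z : (E →L[ℝ] ℝ) × (V →L[ℝ] ℝ) => h z.1 z.2))
    (μ y : E →L[ℝ] ℝ) (a b : V →L[ℝ] ℝ) :
    fderiv ℝ (fun z : (E →L[ℝ] ℝ) × (V →L[ℝ] ℝ) => h z.1 z.2) (μ, a) (y, b) =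
      y (varDeriv (fun m => h m a) μ) + b (varDeriv (fun b => h μ b) a) := by
  rw [apply_varDeriv, apply_varDeriv, (hasFDerivAt_left hh μ a).fderiv,
    (hasFDerivAt_right hh μ a).fderiv, ContinuousLinearMap.comp_apply,
    ContinuousLinearMap.comp_apply, ← map_add]
  simp

/-- The velocity defect `ξ - δh/δμ`. -/
def velocityDefect (h : (E →L[ℝ] ℝ) → (V →L[ℝ] ℝ) → ℝ) (μ : E →L[ℝ] ℝ) (ξ : E)
    (a : V →L[ℝ] ℝ) : E :=
  ξ - varDeriv (fun m => h m a) μ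

/-- The right-hand side `ad*_ξ μ - (δh/δa) ⋄ a` of the momentum equation. -/
def momentumForce (ρ : Representation ℝ G V) (h : (E →L[ℝ] ℝ) → (V →L[ℝ] ℝ) → ℝ)
    (μ : E →L[ℝ] ℝ) (ξ : E) (a : V →L[ℝ] ℝ) : E →L[ℝ] ℝ :=
  adStar G ξ μ - diamond E ρ (varDeriv (fun b => h μ b) a) a

theorem momentumForce_apply (μ : E →L[ℝ] ℝ) (ξ : E) (a : V →L[ℝ] ℝ) (η : E) :
    momentumForce ρ h μ ξ a η =
      μ (bracket G ξ η) + infAct E ρ a η (varDeriv (fun b => h μ b) a) := by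
  rw [← neg_diamond_apply, momentumForce]
  exact sub_eq_add_neg _ _

variable {μ : ℝ → E →L[ℝ] ℝ} {ξ : ℝ → E} {a : ℝ → V →L[ℝ] ℝ} {η : ℝ → E}
  {M : ℝ → ℝ → E →L[ℝ] ℝ} {X : ℝ → ℝ → E} {A : ℝ → ℝ → V →L[ℝ] ℝ} {δμ : ℝ → E →L[ℝ] ℝ}

/-- Only first-order data at `ε = 0` survive: the bracket in `δξ` moves onto `μ` as `ad*_ξ μ`, and
`-h` paired with `δa = -η a` gives the diamond term. The variation need not come from curves in `G`.
-/
theorem IsReducedVariation.hasDerivAt_reducedAction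
    (hh : ContDiff ℝ ∞ (fun z : (E →L[ℝ] ℝ) × (V →L[ℝ] ℝ) => h z.1 z.2)) (ht : t₀ < t₁)
    (hv : IsReducedVariation ρ t₀ t₁ r μ ξ a η M X A)
    (hM : ∀ t ∈ Icc t₀ t₁, HasDerivAt (fun ε => M ε t) (δμ t) 0) :
    HasDerivAt (fun ε => reducedAction t₀ t₁ h (M ε) (X ε) (A ε))
      (∫ t in t₀..t₁, (δμ t (velocityDefect h (μ t) (ξ t) (a t)) +
        μ t (derivWithin η (Icc t₀ t₁) t) + momentumForce ρ h (μ t) (ξ t) (a t) (η t))) 0 := by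
  refine hasDerivAt_intervalIntegral_of_contDiffOn
    (f := fun x : ℝ × ℝ => M x.1 x.2 (X x.1 x.2) - h (M x.1 x.2) (A x.1 x.2)) hv.pos ht ?_ ?_
  · exact (hv.smooth_M.clm_apply hv.smooth_X).sub
      (hh.comp_contDiffOn (hv.smooth_M.prodMk hv.smooth_A))
  · intro t htm
    have h1 := (hM t htm).clm_apply (hv.deriv_X t htm)
    have h2 := (hM t htm).prodMk (hv.deriv_A t htm)
    have h3 : HasFDerivAt (fun z : (E →L[ℝ] ℝ) × (V →L[ℝ] ℝ) => h z.1 z.2)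
        (fderiv ℝ (fun z : (E →L[ℝ] ℝ) × (V →L[ℝ] ℝ) => h z.1 z.2) (M 0 t, A 0 t))
        (M 0 t, A 0 t) := (hh.differentiable (by simp) _).hasFDerivAt
    have h4 := HasFDerivAt.comp_hasDerivAt (f := fun ε => (M ε t, A ε t)) 0 h3 h2
    refine (h1.sub h4).congr_deriv ?_
    rw [fderiv_eq_varDeriv hh, hv.base_M t htm, hv.base_X t htm, hv.base_A t htm,
      momentumForce_apply, velocityDefect, map_sub, map_add]
    simp only [neg_apply]
    ring

omit [FiniteDimensional ℝ E] in
theorem contDiff_bracket_left (η : E) : ContDiff ℝ ∞ (fun ξ : E => bracket G ξ η) := by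
  simp only [← fderiv_maurerCartanChart_sub]
  fun_prop

section Smooth

variable (hρ : ContMDiff (𝓘(ℝ, E).prod 𝓘(ℝ, V)) 𝓘(ℝ, V) ∞ (fun x : G × V => ρ x.1 x.2))
  (hh : ContDiff ℝ ∞ (fun z : (E →L[ℝ] ℝ) × (V →L[ℝ] ℝ) => h z.1 z.2))
  (hμ : ContDiffOn ℝ ∞ μ (Icc t₀ t₁)) (hξ : ContDiffOn ℝ ∞ ξ (Icc t₀ t₁))
  (ha : ContDiffOn ℝ ∞ a (Icc t₀ t₁))

include hh hμ hξ ha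

/-- Paired with a fixed covector, the variational derivative is a value of the total derivative of
`h`, whose smoothness is known. Hence the smoothness in weak form, which is all the fundamental
lemma asks for. -/
theorem contDiffOn_velocityDefect (y : E →L[ℝ] ℝ) :
    ContDiffOn ℝ ∞ (fun t => y (velocityDefect h (μ t) (ξ t) (a t))) (Icc t₀ t₁) := by
  have h1 : ∀ t, y (velocityDefect h (μ t) (ξ t) (a t)) = y (ξ t) -
      fderiv ℝ (fun z : (E →L[ℝ] ℝ) × (V →L[ℝ] ℝ) => h z.1 z.2) (μ t, a t) (y, 0) := by
    intro t
    rw [fderiv_eq_varDeriv hh, velocityDefect, map_sub, zero_apply, add_zero]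
  simp only [h1]
  refine (contDiffOn_const.clm_apply hξ).sub (ContDiffOn.clm_apply ?_ contDiffOn_const)
  exact (hh.fderiv_right (m := ∞) (by simp)).comp_contDiffOn (hμ.prodMk ha)

include hρ

theorem contDiffOn_momentumForce (v : E) :
    ContDiffOn ℝ ∞ (fun t => momentumForce ρ h (μ t) (ξ t) (a t) v) (Icc t₀ t₁) := by
  have h1 : ∀ t, momentumForce ρ h (μ t) (ξ t) (a t) v = μ t (bracket G (ξ t) v) +
      fderiv ℝ (fun z : (E →L[ℝ] ℝ) × (V →L[ℝ] ℝ) => h z.1 z.2) (μ t, a t)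
        (0, -((a t).comp (infRep E ρ v))) := by
    intro t
    rw [fderiv_eq_varDeriv hh, momentumForce_apply, zero_apply, zero_add, infAct_apply hρ]
  simp only [h1]
  refine (hμ.clm_apply ((contDiff_bracket_left v).comp_contDiffOn hξ)).add
    (ContDiffOn.clm_apply ?_ ?_)
  · exact (hh.fderiv_right (m := ∞) (by simp)).comp_contDiffOn (hμ.prodMk ha)
  · exact contDiffOn_const.prodMk (ha.clm_comp contDiffOn_const).neg

end Smooth

theorem LiePoissonEquations.reducedPrinciple
    (hh : ContDiff ℝ ∞ (fun z : (E →L[ℝ] ℝ) × (V →L[ℝ] ℝ) => h z.1 z.2)) (ht : t₀ < t₁)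
    (hμ : ContDiffOn ℝ ∞ μ (Icc t₀ t₁)) (hLP : LiePoissonEquations ρ t₀ t₁ h μ ξ a) :
    ReducedPrinciple ρ t₀ t₁ h μ ξ a := by
  intro r η M X A hv
  have h0 : (0 : ℝ) ∈ Ioo (-r) r := ⟨by linarith [hv.pos], hv.pos⟩
  have hM : ∀ t ∈ Icc t₀ t₁, HasDerivAt (fun ε => M ε t) (deriv (fun ε => M ε t) 0) 0 := by
    intro t htm
    have h1 := hasDerivAt_horizontal hv.pos htm (f := fun x : ℝ × ℝ => M x.1 x.2)
      ((hv.smooth_M (0, t) ⟨h0, htm⟩).differentiableWithinAt (by simp)).hasFDerivWithinAt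
    exact h1.differentiableAt.hasDerivAt
  have h1 := hv.hasDerivAt_reducedAction hh ht hM
  -- The `δμ` term vanishes and the force equals `μ̇`, leaving the total derivative of `⟨μ, η⟩`,
  -- with `η` zero at both ends.
  rwa [intervalIntegral.integral_congr, integral_pairing_eq_zero ht hμ hv.smooth_η hv.left
    hv.right] at h1
  intro t htm
  rw [uIcc_of_le ht.le] at htm
  obtain ⟨e1, e2, -⟩ := hLP t htm
  have e3 : velocityDefect h (μ t) (ξ t) (a t) = 0 := by
    rw [velocityDefect, ← e1, sub_self]
  have e4 : momentumForce ρ h (μ t) (ξ t) (a t) = derivWithin μ (Icc t₀ t₁) t :=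
    (e2.derivWithin (uniqueDiffOn_Icc ht t htm)).symm
  simp only [e3, e4, map_zero, zero_add]
  ring

end Reduced

/-! ### The variational principles and the Lie–Poisson equations -/

section Main

variable {E : Type*} [NormedAddCommGroup E] [NormedSpace ℝ E] [FiniteDimensional ℝ E]
  {G : Type*} [TopologicalSpace G] [ChartedSpace E G] [Group G] [LieGroup 𝓘(ℝ, E) ∞ G]
  {V : Type*} [NormedAddCommGroup V] [NormedSpace ℝ V] [FiniteDimensional ℝ V]
  {ρ : Representation ℝ G V}
  (hρ : ContMDiff (𝓘(ℝ, E).prod 𝓘(ℝ, V)) 𝓘(ℝ, V) ∞ (fun x : G × V => ρ x.1 x.2))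
  {H : CotangentBundle E G × (V →L[ℝ] ℝ) → ℝ}
  (hH : ContMDiff ((cotangentModel E).prod 𝓘(ℝ, V →L[ℝ] ℝ)) 𝓘(ℝ, ℝ) ∞ H)
  (hinv : IsLeftInvariant ρ H) (a₀ : V →L[ℝ] ℝ) {t₀ t₁ : ℝ} (ht : t₀ < t₁)
  {α : ℝ → CotangentBundle E G}
  (hα : ContMDiffOn 𝓘(ℝ, ℝ) (cotangentModel E) ∞ α (Icc t₀ t₁))

include hρ hinv ht

theorem phaseSpacePrinciple_of_reducedPrinciple
    (hR : ReducedPrinciple ρ t₀ t₁ (reducedHamiltonian H) (fun t => bodyMomentum (α t))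
      (fun t => bodyVelocity E t₀ t₁ (fun s => (α s).1) t)
      (fun t => dualAct ρ ((α t).1)⁻¹ a₀)) :
    PhaseSpacePrinciple t₀ t₁ (fun β => H (β, a₀)) α := by
  intro r Γ hΓ
  refine (hR r _ _ _ _ (hΓ.isReducedVariation hρ a₀ ht)).congr_of_eventuallyEq ?_
  filter_upwards [Ioo_mem_nhds (neg_lt_zero.2 hΓ.pos) hΓ.pos] with ε hε
  exact hΓ.phaseAction_eq hinv a₀ ht hε

include hα

omit hinv in
theorem contDiffOn_body :
    ContDiffOn ℝ ∞ (fun t => bodyMomentum (α t)) (Icc t₀ t₁) ∧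
    ContDiffOn ℝ ∞ (fun t => bodyVelocity E t₀ t₁ (fun s => (α s).1) t) (Icc t₀ t₁) ∧
    ContDiffOn ℝ ∞ (fun t => dualAct ρ ((α t).1)⁻¹ a₀) (Icc t₀ t₁) ∧
    ∀ t ∈ Icc t₀ t₁, HasDerivWithinAt (fun t => dualAct ρ ((α t).1)⁻¹ a₀)
      (-(infAct E ρ (dualAct ρ ((α t).1)⁻¹ a₀)
        (bodyVelocity E t₀ t₁ (fun s => (α s).1) t))) (Icc t₀ t₁) t := by
  have hα' := fun t htm => contMDiffWithinAt_cotangent_iff.1 (hα t htm)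
  have hU := uniqueDiffOn_Icc ht
  refine ⟨fun t htm => (hα' t htm).2, ?_, fun t htm => contDiffWithinAt_dualAct_inv hρ
    (hα' t htm).1 a₀, fun t htm => ?_⟩
  · have h1 : ContDiffOn ℝ ∞ (fun t => leftLogDeriv (E := E) (Icc t₀ t₁) (fun s => (α s).1) t 1)
        (Icc t₀ t₁) :=
      ContDiffOn.clm_apply
        (fun t htm => contDiffWithinAt_leftLogDeriv (hα' t htm).1 hU htm) contDiffOn_const
    exact h1.congr fun t htm => bodyVelocity_eq_leftLogDeriv ht htm (hα' t htm).1
  · have h1 := (hasFDerivWithinAt_dualAct_inv hρ (hα' t htm).1 a₀).hasDerivWithinAt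
    rw [bodyVelocity_eq_leftLogDeriv ht htm (hα' t htm).1]
    exact h1

include hH

/-- Stationarity is tested on the variations realizing each pair `(η, δμ)`, and the fundamental
lemma is applied to the resulting first variation. The equation for `a` needs no stationarity beyond
`ξ = δh/δμ`. -/
theorem liePoissonEquations_of_phaseSpacePrinciple
    (hP : PhaseSpacePrinciple t₀ t₁ (fun β => H (β, a₀)) α) :
    LiePoissonEquations ρ t₀ t₁ (reducedHamiltonian H) (fun t => bodyMomentum (α t))
      (fun t => bodyVelocity E t₀ t₁ (fun s => (α s).1) t)
      (fun t => dualAct ρ ((α t).1)⁻¹ a₀) := by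
  have hh := contDiff_reducedHamiltonian hH
  obtain ⟨hμ, hξ, ha, hda⟩ := contDiffOn_body hρ a₀ ht hα
  have key := eq_zero_and_derivWithin_eq_of_forall_integral_eq_zero ht hμ
    (contDiffOn_velocityDefect hh hμ hξ ha) (contDiffOn_momentumForce hρ hh hμ hξ ha) ?_
  · intro t htm
    obtain ⟨h1, h2⟩ := key t htm
    have h3 := sub_eq_zero.1 h1
    refine ⟨h3, ?_, ?_⟩
    · exact ((hμ t htm).differentiableWithinAt (by simp)).hasDerivWithinAt.congr_deriv h2
    · exact (hda t htm).congr_deriv (by rw [← h3])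
  · intro η δμ hη hδμ h₀ h₁
    obtain ⟨r, hΓ, hr⟩ := exists_isPhaseVariation hα hη hδμ h₀ h₁
    have hv := hΓ.isReducedVariation hρ a₀ ht
    have h1 := hv.hasDerivAt_reducedAction hh ht fun t htm => (hr t htm).1
    have h2 := (hP r _ hΓ).congr_of_eventuallyEq
      (f₁ := fun ε => reducedAction t₀ t₁ (reducedHamiltonian H)
        (fun t => bodyMomentum (trivializedVariation α η δμ ε t))
        (fun t => leftLogDeriv (Ioo (-r) r ×ˢ Icc t₀ t₁)
          (fun x : ℝ × ℝ => (trivializedVariation α η δμ x.1 x.2).1) (ε, t) (0, 1))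
        (fun t => dualAct ρ ((trivializedVariation α η δμ ε t).1)⁻¹ a₀)) (by
      filter_upwards [Ioo_mem_nhds (neg_lt_zero.2 hΓ.pos) hΓ.pos] with ε hε
      exact (hΓ.phaseAction_eq hinv a₀ ht hε).symm)
    rw [← h1.unique h2]
    refine intervalIntegral.integral_congr fun t htm => ?_
    rw [uIcc_of_le ht.le] at htm
    have e1 := (hr t htm).2
    -- The realized direction agrees with the prescribed `η` only on `[t₀, t₁]`, which suffices for
    -- derivatives within that interval.
    have e2 := derivWithin_congr (fun s hs => (hr s hs).2) e1
    simp only [e1, e2]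

end Main

/-! ### Hamilton's equations in canonical coordinates -/

section Hamilton

variable {E : Type*} [NormedAddCommGroup E] [NormedSpace ℝ E] [FiniteDimensional ℝ E]
  {G : Type*} [TopologicalSpace G] [ChartedSpace E G] [Group G] [LieGroup 𝓘(ℝ, E) ∞ G]
  {V : Type*} [NormedAddCommGroup V] [NormedSpace ℝ V] [FiniteDimensional ℝ V]
  {ρ : Representation ℝ G V}
  {H : CotangentBundle E G × (V →L[ℝ] ℝ) → ℝ}
  {t₀ t₁ : ℝ} {α : ℝ → CotangentBundle E G}

/-- Differentiating `p = μ ∘ A(q)` by the product rule gives `p' = μ' ∘ A + μ ∘ DA(q')`, with `A q'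
= ξ`. -/
theorem hasDerivWithinAt_chart (ht : t₀ < t₁)
    (hα : ContMDiffOn 𝓘(ℝ, ℝ) (cotangentModel E) ∞ α (Icc t₀ t₁)) {t : ℝ} (htm : t ∈ Icc t₀ t₁)
    {α₀ : CotangentBundle E G} (hs : (α t).1 ∈ (extChartAt 𝓘(ℝ, E) α₀.1).source) :
    ∃ q' : E, chartForm α₀.1 (extChartAt 𝓘(ℝ, E) α₀.1 (α t).1) q' =
        bodyVelocity E t₀ t₁ (fun s => (α s).1) t ∧
      HasDerivWithinAt (fun s => extChartAt (cotangentModel E) α₀ (α s))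
        (q', (derivWithin (fun s => bodyMomentum (α s)) (Icc t₀ t₁) t).comp
            (chartForm α₀.1 (extChartAt 𝓘(ℝ, E) α₀.1 (α t).1)) +
          (bodyMomentum (α t)).comp
            (fderiv ℝ (chartForm α₀.1) (extChartAt 𝓘(ℝ, E) α₀.1 (α t).1) q'))
        (Icc t₀ t₁) t := by
  set ψ := extChartAt 𝓘(ℝ, E) α₀.1 with hψ
  obtain ⟨hg, hμ⟩ := contMDiffWithinAt_cotangent_iff.1 (hα t htm)
  have hU := uniqueDiffOn_Icc ht t htm
  have h1 : HasDerivWithinAt (fun s => ψ (α s).1)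
      (fderivWithin ℝ (fun s => ψ (α s).1) (Icc t₀ t₁) t 1) (Icc t₀ t₁) t :=
    ((contDiffWithinAt_extChartAt_comp hg hs).differentiableWithinAt
      (by simp)).hasFDerivWithinAt.hasDerivWithinAt
  refine ⟨fderivWithin ℝ (fun s => ψ (α s).1) (Icc t₀ t₁) t 1, ?_, ?_⟩
  · rw [bodyVelocity_eq_leftLogDeriv ht htm hg, leftLogDeriv_eq_chartForm_comp hg hU hs]
    rfl
  · have h2 : HasFDerivAt (chartForm α₀.1) (fderiv ℝ (chartForm α₀.1) (ψ (α t).1)) (ψ (α t).1) :=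
      ((contDiffAt_chartForm (ψ.map_source hs)).differentiableAt (by simp)).hasFDerivAt
    have h3 := (hμ.differentiableWithinAt (by simp)).hasDerivWithinAt.clm_comp
      (h2.comp_hasDerivWithinAt t h1)
    refine (h1.prodMk h3).congr_of_eventuallyEq ?_ (extChartAt_cotangent hs)
    have h4 : ∀ᶠ s in 𝓝[Icc t₀ t₁] t, (α s).1 ∈ ψ.source :=
      hg.continuousWithinAt.preimage_mem_nhdsWithin ((isOpen_extChartAt_source _).mem_nhds hs)
    exact h4.mono fun s hs => extChartAt_cotangent hs

variable (hρ : ContMDiff (𝓘(ℝ, E).prod 𝓘(ℝ, V)) 𝓘(ℝ, V) ∞ (fun x : G × V => ρ x.1 x.2))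
  (hH : ContMDiff ((cotangentModel E).prod 𝓘(ℝ, V →L[ℝ] ℝ)) 𝓘(ℝ, ℝ) ∞ H)
  (hinv : IsLeftInvariant ρ H) (a₀ : V →L[ℝ] ℝ)

include hρ hH hinv

/-- The differential of the Hamiltonian in canonical coordinates, in terms of the reduced
Hamiltonian. -/
theorem fderiv_hamiltonian_chart {α₀ β : CotangentBundle E G}
    (hs : β.1 ∈ (extChartAt 𝓘(ℝ, E) α₀.1).source) (v : E) (ν : E →L[ℝ] ℝ) :
    fderiv ℝ (fun z => H ((extChartAt (cotangentModel E) α₀).symm z, a₀))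
      (extChartAt (cotangentModel E) α₀ β)
      (v, ν.comp (chartForm α₀.1 (extChartAt 𝓘(ℝ, E) α₀.1 β.1)) +
        (bodyMomentum β).comp (fderiv ℝ (chartForm α₀.1) (extChartAt 𝓘(ℝ, E) α₀.1 β.1) v)) =
    ν (varDeriv (fun m => reducedHamiltonian H m (dualAct ρ (β.1)⁻¹ a₀)) (bodyMomentum β)) -
      infAct E ρ (dualAct ρ (β.1)⁻¹ a₀) (chartForm α₀.1 (extChartAt 𝓘(ℝ, E) α₀.1 β.1) v)
        (varDeriv (fun b => reducedHamiltonian H (bodyMomentum β) b) (dualAct ρ (β.1)⁻¹ a₀)) := by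
  set ψ := extChartAt 𝓘(ℝ, E) α₀.1 with hψ
  set μ := bodyMomentum β with hμ
  set q := ψ β.1 with hq
  have hqt : q ∈ ψ.target := ψ.map_source hs
  have hqs : ψ.symm q = β.1 := ψ.left_inv hs
  have hsrc : β ∈ (extChartAt (cotangentModel E) α₀).source := mem_extChartAt_cotangent_source.2 hs
  have hβ : extChartAt (cotangentModel E) α₀ β = (q, μ.comp (chartForm α₀.1 q)) :=
    extChartAt_cotangent hs
  have hd1 : HasFDerivAt (fun z => H ((extChartAt (cotangentModel E) α₀).symm z, a₀))
      (fderiv ℝ (fun z => H ((extChartAt (cotangentModel E) α₀).symm z, a₀))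
        (q, μ.comp (chartForm α₀.1 q))) (q, μ.comp (chartForm α₀.1 q)) := by
    refine DifferentiableAt.hasFDerivAt ?_
    have h1 : ContMDiffAt 𝓘(ℝ, E × (E →L[ℝ] ℝ)) (cotangentModel E) ∞
        (extChartAt (cotangentModel E) α₀).symm (q, μ.comp (chartForm α₀.1 q)) := by
      rw [← hβ]
      exact (contMDiffOn_extChartAt_symm α₀ _ ((extChartAt _ α₀).map_source hsrc)).contMDiffAt
        ((isOpen_extChartAt_target α₀).mem_nhds ((extChartAt _ α₀).map_source hsrc))
    have h2 : ContMDiffAt 𝓘(ℝ, E × (E →L[ℝ] ℝ)) 𝓘(ℝ, ℝ) ∞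
        (fun z => H ((extChartAt (cotangentModel E) α₀).symm z, a₀))
        (q, μ.comp (chartForm α₀.1 q)) :=
      hH.contMDiffAt.comp _ (h1.prodMk contMDiffAt_const)
    exact h2.contDiffAt.differentiableAt (by simp)
  have hA : HasFDerivAt (chartForm α₀.1) (fderiv ℝ (chartForm α₀.1) q) q :=
    ((contDiffAt_chartForm hqt).differentiableAt (by simp)).hasFDerivAt
  have hh := contDiff_reducedHamiltonian hH
  have hline : HasDerivAt (fun s : ℝ => q + s • v) v 0 := by
    simpa using ((hasDerivAt_id (0 : ℝ)).smul_const v).const_add q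
  have hlineμ : HasDerivAt (fun s : ℝ => μ + s • ν) ν 0 := by
    simpa using ((hasDerivAt_id (0 : ℝ)).smul_const ν).const_add μ
  have hq0 : q + (0 : ℝ) • v = q := by simp
  have hμ0 : μ + (0 : ℝ) • ν = μ := by simp
  have hA' : HasDerivAt (fun s : ℝ => chartForm α₀.1 (q + s • v)) (fderiv ℝ (chartForm α₀.1) q v)
      0 := by
    rw [← hq0] at hA
    have := hA.comp_hasDerivAt (0 : ℝ) hline
    rwa [hq0] at this
  -- The curve `s ↦ (q + s v, (μ + s ν) ∘ A(q + s v))` has body momentum exactly `μ + s ν`, so along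
  -- it `H` is `h` at an affine momentum. Equating the two computations of the derivative gives the
  -- claim.
  have hL : HasDerivAt (fun s : ℝ => H ((extChartAt (cotangentModel E) α₀).symm
      (q + s • v, (μ + s • ν).comp (chartForm α₀.1 (q + s • v))), a₀))
      (fderiv ℝ (fun z => H ((extChartAt (cotangentModel E) α₀).symm z, a₀))
        (q, μ.comp (chartForm α₀.1 q)) (v, ν.comp (chartForm α₀.1 q) +
          μ.comp (fderiv ℝ (chartForm α₀.1) q v))) 0 := by
    have h1 := hline.prodMk (hlineμ.clm_comp hA')
    simp only [hq0, hμ0] at h1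
    have hd2 : HasFDerivAt (fun z => H ((extChartAt (cotangentModel E) α₀).symm z, a₀))
        (fderiv ℝ (fun z => H ((extChartAt (cotangentModel E) α₀).symm z, a₀))
          (q, μ.comp (chartForm α₀.1 q)))
        (q + (0 : ℝ) • v, (μ + (0 : ℝ) • ν).comp (chartForm α₀.1 (q + (0 : ℝ) • v))) := by
      rw [hq0, hμ0]
      exact hd1
    exact HasFDerivAt.comp_hasDerivAt (f := fun s : ℝ =>
      (q + s • v, (μ + s • ν).comp (chartForm α₀.1 (q + s • v)))) (0 : ℝ) hd2 h1
  have hb : HasDerivAt (fun s : ℝ => dualAct ρ (ψ.symm (q + s • v))⁻¹ a₀)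
      (-(infAct E ρ (dualAct ρ (β.1)⁻¹ a₀) (chartForm α₀.1 q v))) 0 := by
    have h1 := hasFDerivWithinAt_univ.1
      (hasFDerivWithinAt_dualAct_inv hρ (contMDiffWithinAt_univ_extChartAt_symm hqt) a₀)
    have h2 : HasFDerivAt (fun y => dualAct ρ (ψ.symm y)⁻¹ a₀)
      (-((infAct E ρ (dualAct ρ (ψ.symm q)⁻¹ a₀)).comp (chartForm α₀.1 q))) (q + (0 : ℝ) • v) := by
      rw [hq0]
      exact h1
    rw [hqs] at h2
    exact h2.comp_hasDerivAt (0 : ℝ) hline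
  have hR : HasDerivAt (fun s : ℝ => reducedHamiltonian H (μ + s • ν)
      (dualAct ρ (ψ.symm (q + s • v))⁻¹ a₀))
      (ν (varDeriv (fun m => reducedHamiltonian H m (dualAct ρ (β.1)⁻¹ a₀)) μ) -
      infAct E ρ (dualAct ρ (β.1)⁻¹ a₀) (chartForm α₀.1 q v)
        (varDeriv (fun b => reducedHamiltonian H μ b) (dualAct ρ (β.1)⁻¹ a₀))) 0 := by
    have h1 := HasFDerivAt.comp_hasDerivAt (f := fun s : ℝ =>
      (μ + s • ν, dualAct ρ (ψ.symm (q + s • v))⁻¹ a₀)) (0 : ℝ)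
      (hh.differentiable (by simp) _).hasFDerivAt (hlineμ.prodMk hb)
    refine h1.congr_deriv ?_
    rw [fderiv_eq_varDeriv hh, hμ0, hq0, hqs, neg_apply, sub_eq_add_neg]
  rw [hβ]
  refine hL.unique (hR.congr_of_eventuallyEq ?_)
  have h4 : ∀ᶠ s : ℝ in 𝓝 0, q + s • v ∈ ψ.target := by
    refine hline.continuousAt.preimage_mem_nhds ((isOpen_extChartAt_target _).mem_nhds ?_)
    rw [hq0]
    exact hqt
  filter_upwards [h4] with s hs
  rw [extChartAt_cotangent_symm α₀ hs, ContinuousLinearMap.comp_assoc,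
    (isInvertible_chartForm hs).self_comp_inverse, ContinuousLinearMap.comp_id,
    hinv.eq_reducedHamiltonian, bodyMomentum_ofBody, ofBody_fst]

/-- At a point, Hamilton's equations in canonical coordinates say that the velocity defect
vanishes and that the momentum equation holds. -/
theorem hamilton_chart_iff {α₀ β : CotangentBundle E G}
    (hs : β.1 ∈ (extChartAt 𝓘(ℝ, E) α₀.1).source) (q' ξ : E) (μ' : E →L[ℝ] ℝ)
    (hξ : chartForm α₀.1 (extChartAt 𝓘(ℝ, E) α₀.1 β.1) q' = ξ) :
    ((∀ y : E →L[ℝ] ℝ, y q' =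
        fderiv ℝ (fun z => H ((extChartAt (cotangentModel E) α₀).symm z, a₀))
          (extChartAt (cotangentModel E) α₀ β) (0, y)) ∧
      ∀ v : E, (μ'.comp (chartForm α₀.1 (extChartAt 𝓘(ℝ, E) α₀.1 β.1)) + (bodyMomentum β).comp
          (fderiv ℝ (chartForm α₀.1) (extChartAt 𝓘(ℝ, E) α₀.1 β.1) q')) v =
        - fderiv ℝ (fun z => H ((extChartAt (cotangentModel E) α₀).symm z, a₀))
          (extChartAt (cotangentModel E) α₀ β) (v, 0)) ↔
    ξ = varDeriv (fun m => reducedHamiltonian H m (dualAct ρ (β.1)⁻¹ a₀)) (bodyMomentum β) ∧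
      μ' = momentumForce ρ (reducedHamiltonian H) (bodyMomentum β) ξ (dualAct ρ (β.1)⁻¹ a₀) := by
  have key := fderiv_hamiltonian_chart hρ hH hinv a₀ hs
  have hqt := (extChartAt 𝓘(ℝ, E) α₀.1).map_source hs
  set μ := bodyMomentum β with hμ
  set q := extChartAt 𝓘(ℝ, E) α₀.1 β.1 with hq
  set κ := fderiv ℝ (fun z => H ((extChartAt (cotangentModel E) α₀).symm z, a₀))
    (extChartAt (cotangentModel E) α₀ β) with hκ
  set A := chartForm α₀.1 q with hAdef
  set D := fderiv ℝ (chartForm α₀.1) q with hD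
  set hm := varDeriv (fun m => reducedHamiltonian H m (dualAct ρ (β.1)⁻¹ a₀)) μ with hmdef
  obtain ⟨e, he⟩ := isInvertible_chartForm hqt
  have he' : ∀ v, e v = A v := fun v => congrArg (fun B : E →L[ℝ] E => B v) he
  -- The term `D q'` comes from `p'` and the term `D v` from `∂H/∂q` at fixed canonical momentum;
  -- their difference is the bracket.
  have hMC : ∀ v, D v q' - D q' v = bracket G ξ (A v) := fun v => by
    rw [← hξ]
    exact fderiv_chartForm_sub hqt v q'
  have k0 : ∀ ν : E →L[ℝ] ℝ, κ (0, ν.comp A) = ν hm := by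
    intro ν
    simpa using key 0 ν
  have hfst : (∀ y : E →L[ℝ] ℝ, y q' = κ (0, y)) ↔ ξ = hm := by
    constructor
    · intro h
      refine (SeparatingDual.eq_iff_forall_dual_eq (R := ℝ)).2 fun ν => ?_
      rw [← k0, ← h, ← hξ]
      rfl
    · intro h y
      -- Invertibility of `A` makes every canonical covector the image of a body covector.
      have hy : y = (y.comp (e.symm : E →L[ℝ] E)).comp A := by
        ext v
        simp [← he']
      rw [hy, k0, ← h, ← hξ]
      rfl
  have hv : ∀ v, κ (v, 0) = -(infAct E ρ (dualAct ρ (β.1)⁻¹ a₀) (A v)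
      (varDeriv (fun b => reducedHamiltonian H μ b) (dualAct ρ (β.1)⁻¹ a₀))) -
        κ (0, μ.comp (D v)) := by
    intro v
    have h1 := key v 0
    rw [ContinuousLinearMap.zero_comp, zero_add, zero_apply, zero_sub] at h1
    rw [← h1, ← map_sub]
    simp
  rw [hfst]
  refine and_congr_right fun h => ?_
  have hfst' := hfst.2 h
  have hsnd : ∀ v, ((μ'.comp A + μ.comp (D q')) v = -κ (v, 0)) ↔
      μ' (A v) = momentumForce ρ (reducedHamiltonian H) μ ξ (dualAct ρ (β.1)⁻¹ a₀) (A v) := by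
    intro v
    rw [hv, ← hfst', momentumForce_apply, ← hMC, map_sub]
    simp only [add_apply, ContinuousLinearMap.comp_apply]
    constructor <;> intro h <;> linarith
  simp only [hsnd]
  constructor
  · intro h
    ext v
    have := h (e.symm v)
    rwa [← he', e.apply_symm_apply] at this
  · intro h v
    rw [h]

theorem hamiltonEquations_iff_liePoissonEquations (ht : t₀ < t₁)
    (hα : ContMDiffOn 𝓘(ℝ, ℝ) (cotangentModel E) ∞ α (Icc t₀ t₁)) :
    HamiltonEquations t₀ t₁ (fun β => H (β, a₀)) α ↔
      LiePoissonEquations ρ t₀ t₁ (reducedHamiltonian H) (fun t => bodyMomentum (α t))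
        (fun t => bodyVelocity E t₀ t₁ (fun s => (α s).1) t)
        (fun t => dualAct ρ ((α t).1)⁻¹ a₀) := by
  obtain ⟨hμ, -, -, hda⟩ := contDiffOn_body hρ a₀ ht hα
  have hU := uniqueDiffOn_Icc ht
  constructor
  · intro h t htm
    -- One canonical chart at each time is enough for this direction; the converse then gives the
    -- equations in all charts.
    obtain ⟨q', p', hd, h1, h2⟩ := h t htm (α t) (mem_extChartAt_source _)
    have hs : (α t).1 ∈ (extChartAt 𝓘(ℝ, E) (α t).1).source := mem_extChartAt_source _
    obtain ⟨q'', hq'', hd'⟩ := hasDerivWithinAt_chart ht hα htm hs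
    obtain ⟨rfl, rfl⟩ := Prod.mk.inj ((hU t htm).eq_deriv _ hd hd')
    obtain ⟨e1, e2⟩ := (hamilton_chart_iff hρ hH hinv a₀ hs _ _ _ hq'').1 ⟨h1, h2⟩
    refine ⟨e1, ?_, ?_⟩
    · exact ((hμ t htm).differentiableWithinAt (by simp)).hasDerivWithinAt.congr_deriv e2
    · exact (hda t htm).congr_deriv (by rw [← e1])
  · intro h t htm α₀ hsrc
    have hs := mem_extChartAt_cotangent_source.1 hsrc
    obtain ⟨e1, e2, -⟩ := h t htm
    obtain ⟨q', hq', hd⟩ := hasDerivWithinAt_chart ht hα htm hs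
    exact ⟨q', _, hd, (hamilton_chart_iff hρ hH hinv a₀ hs _ _ _ hq').2
      ⟨e1, e2.derivWithin (hU t htm)⟩⟩

end Hamilton

end HamiltonPoincare

end

/-! ### The equivalence of the four statements -/

theorem mainTheorem2
    {E : Type*} [NormedAddCommGroup E] [NormedSpace ℝ E] [FiniteDimensional ℝ E]
    {G : Type*} [TopologicalSpace G] [ChartedSpace E G] [Group G] [LieGroup 𝓘(ℝ, E) ∞ G]
    {V : Type*} [NormedAddCommGroup V] [NormedSpace ℝ V] [FiniteDimensional ℝ V]
    (ρ : Representation ℝ G V)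
    (hρ : ContMDiff (𝓘(ℝ, E).prod 𝓘(ℝ, V)) 𝓘(ℝ, V) ∞ (fun x : G × V => ρ x.1 x.2))
    (H : HamiltonPoincare.CotangentBundle E G × (V →L[ℝ] ℝ) → ℝ)
    (hH : ContMDiff ((HamiltonPoincare.cotangentModel E).prod 𝓘(ℝ, V →L[ℝ] ℝ)) 𝓘(ℝ, ℝ) ∞ H)
    (hinv : HamiltonPoincare.IsLeftInvariant ρ H)
    (a₀ : V →L[ℝ] ℝ) (t₀ t₁ : ℝ) (ht : t₀ < t₁)
    (α : ℝ → HamiltonPoincare.CotangentBundle E G)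
    (hα : ContMDiffOn 𝓘(ℝ, ℝ) (HamiltonPoincare.cotangentModel E) ∞ α (Set.Icc t₀ t₁))
    (μ : ℝ → E →L[ℝ] ℝ) (hμ : ∀ t, μ t = HamiltonPoincare.bodyMomentum (α t))
    (ξ : ℝ → E) (hξ : ∀ t, ξ t = HamiltonPoincare.bodyVelocity E t₀ t₁ (fun s => (α s).1) t)
    (a : ℝ → V →L[ℝ] ℝ) (ha : ∀ t, a t = HamiltonPoincare.dualAct ρ ((α t).1)⁻¹ a₀) :
    List.TFAE
      [HamiltonPoincare.PhaseSpacePrinciple t₀ t₁ (fun β => H (β, a₀)) α,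
       HamiltonPoincare.HamiltonEquations t₀ t₁ (fun β => H (β, a₀)) α,
       HamiltonPoincare.ReducedPrinciple ρ t₀ t₁
         (HamiltonPoincare.reducedHamiltonian H) μ ξ a,
       HamiltonPoincare.LiePoissonEquations ρ t₀ t₁
         (HamiltonPoincare.reducedHamiltonian H) μ ξ a] := by
  obtain rfl : μ = fun t => HamiltonPoincare.bodyMomentum (α t) := funext hμ
  obtain rfl : ξ = fun t => HamiltonPoincare.bodyVelocity E t₀ t₁ (fun s => (α s).1) t := funext hξ
  obtain rfl : a = fun t => HamiltonPoincare.dualAct ρ ((α t).1)⁻¹ a₀ := funext ha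
  have hμs := (HamiltonPoincare.contDiffOn_body hρ a₀ ht hα).1
  have h14 := HamiltonPoincare.liePoissonEquations_of_phaseSpacePrinciple hρ hH hinv a₀ ht hα
  have h24 := HamiltonPoincare.hamiltonEquations_iff_liePoissonEquations hρ hH hinv a₀ ht hα
  have h31 := HamiltonPoincare.phaseSpacePrinciple_of_reducedPrinciple (α := α) hρ hinv a₀ ht
  have h43 := HamiltonPoincare.LiePoissonEquations.reducedPrinciple (ρ := ρ)
    (ξ := fun t => HamiltonPoincare.bodyVelocity E t₀ t₁ (fun s => (α s).1) t)
    (a := fun t => HamiltonPoincare.dualAct ρ ((α t).1)⁻¹ a₀)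
    (HamiltonPoincare.contDiff_reducedHamiltonian hH) ht hμs
  -- Reaching (3) from (4), not from (1), avoids having to lift a general reduced variation to the
  -- group.
  tfae_have 1 → 4 := h14
  tfae_have 2 ↔ 4 := h24
  tfae_have 3 → 1 := h31
  tfae_have 4 → 3 := h43
  tfae_finish
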